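/- Let $\mathbb{O}=\mathrm{span}_{\mathbb R}\{e_0=1,e_1,\dots,e_7\}\cong\mathbb{R}^8$ be the octonions, with $e_ie_j=-\delta_{ij}+\sum_{k}\epsilon_{ijk}e_k$ for $1\le i,j\le 7$, where $\epsilon$ is totally antisymmetric, equals $1$ on $(1,2,3),(1,4,5),(2,4,6),(3,4,7),(5,3,6),(6,1,7),(7,2,5)$ and vanishes on triples that are not permutations of these. Fix $p\in\{0,1,\dots,6\}$, let $\mathbb{R}^{p+1}=\mathrm{span}\{e_0,\dots,e_p\}$, and let $\mathbb{S}=\{\sum_{i=p+1}^7x_ie_i:\sum_{i=p+1}^7 x_i^2=1\}$. A domain is a nonempty connected open set. For an open set $\Omega\subseteq\mathbb{O}$ and $\omega\in\mathbb{S}$ put $\Omega_\omega=\Omega\cap(\mathbb{R}^{p+1}\oplus\omega\mathbb{R})$, regarded as an open subset of $\mathbb{R}^{p+2}$ with coordinates $(x_0,\dots,x_p,r)$, and let $f_\omega$ be the restriction of $f$ to $\Omega_\omega$. Let $$D_\omega=\sum_{i=0}^p e_i\,\partial_{x_i}+\omega\,\partial_r .$$ A function $f:\Omega\to\mathbb{O}$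 on a domain $\Omega$ is (left) generalized partial-slice monogenic of type $p$ if, for every $\omega\in\mathbb{S}$, $f_\omega\in C^1(\Omega_\omega,\mathbb{O})$ and $D_\omega f_\omega=0$ in $\Omega_\omega$. A slice domain is a domain $\Omega\subseteq\mathbb{O}$ such that $\Omega\cap\mathbb{R}^{p+1}\neq\emptyset$ and $\Omega_\omega$ is a domain in $\mathbb{R}^{p+2}$ for every $\omega\in\mathbb{S}$. A $(p+1)$-dimensional smooth manifold in $\Omega_\omega$ means the image of a nonempty smooth $(p+1)$-dimensional manifold under a smooth immersion into $\Omega_\omega$ (for example, a nonempty embedded submanifold). Theorem (Identity theorem). 1. Let $\eta\in\mathbb{S}$, let $\Omega\subseteq\mathbb{O}$ be a domain such that $\Omega_\eta$ is a domain in $\mathbb{R}^{p+2}$, and let $f_\eta\in C^1(\Omega_\eta,\mathbb{O})$ satisfy $D_\eta f_\eta=0$ in $\Omega_\eta$. If the zero set of $f_\eta$ contains a $(p+1)$-dimensional smooth manifold in $\Omega_\eta$, then $f_\eta\equiv0$ in $\Omega_\eta$. 2. Let $\Omega$ be a slice domain and let $f:\Omega\to\mathbb{O}$ be generalized partial-slice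 monogenic. If for some $\eta\in\mathbb{S}$ the zero set of $f$ contains a $(p+1)$-dimensional smooth manifold in $\Omega_\eta$, then $f\equiv0$ in $\Omega$. 3. Let $\Omega$ be a slice domain and let $f,g:\Omega\to\mathbb{O}$ be generalized partial-slice monogenic. If for some $\omega\in\mathbb{S}$ one has $f=g$ on a $(p+1)$-dimensional smooth manifold in $\Omega_\omega$, then $f\equiv g$ in $\Omega$. -/

import Mathlib

open scoped Manifold ContDiff

noncomputable section

/-- The underlying Euclidean space of the octonions: `x = x₀ + ∑ xᵢ eᵢ` is identified with
`(x₀, …, x₇) ∈ ℝ⁸`. -/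
abbrev Octonion : Type := EuclideanSpace ℝ (Fin 8)

namespace Octonion

/-- The seven oriented triples `(i, j, k)` with `eᵢ eⱼ = eₖ`. -/
def triples : List (Fin 8 × Fin 8 × Fin 8) :=
  [(1, 2, 3), (1, 4, 5), (2, 4, 6), (3, 4, 7), (5, 3, 6), (6, 1, 7), (7, 2, 5)]

/-- The totally antisymmetric symbol `εᵢⱼₖ`: the sign of the permutation carrying one of the
seven triples to `(i, j, k)`, and zero if there is none. (Even permutations of three letters are
the cyclic ones.) -/
def eps (i j k : Fin 8) : ℤ :=
  if (i, j, k) ∈ triples ∨ (j, k, i) ∈ triples ∨ (k, i, j) ∈ triples then 1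
  else if (j, i, k) ∈ triples ∨ (i, k, j) ∈ triples ∨ (k, j, i) ∈ triples then -1
  else 0

/-- The coefficient of `eₖ` in the product `eᵢ eⱼ`: `e₀ = 1` is the unit and
`eᵢ eⱼ = -δᵢⱼ + ∑ₖ εᵢⱼₖ eₖ` for `i, j ≥ 1`. -/
def structConst (i j k : Fin 8) : ℤ :=
  if i = 0 then (if k = j then 1 else 0)
  else if j = 0 then (if k = i then 1 else 0)
  else if k = 0 then (if i = j then -1 else 0)
  else eps i j k

/-- Octonion multiplication, the bilinear extension of the multiplication rule of the basis. -/
def mul (x y : Octonion) : Octonion :=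
  WithLp.toLp 2 fun k => ∑ i, ∑ j, x i * y j * (structConst i j k : ℝ)

/-- The basis element `eᵢ`. -/
def e (i : Fin 8) : Octonion := EuclideanSpace.single i 1

end Octonion

/-- The coordinate space `ℝᵖ⁺²` of a slice, with coordinates `(x₀, …, x_p, r)`. -/
abbrev SliceSpace (p : Fin 7) : Type := EuclideanSpace ℝ (Fin ((p : ℕ) + 2))

/-- The subspace `ℝᵖ⁺¹` of the octonions spanned by `e₀, …, e_p`. -/
def paravectors (p : Fin 7) : Set Octonion := {x | ∀ i : Fin 8, (p : ℕ) < (i : ℕ) → x i = 0}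

/-- The unit sphere `𝕊` of the span of `e_{p+1}, …, e₇`. -/
def imagSphere (p : Fin 7) : Set Octonion :=
  {w | (∀ i : Fin 8, (i : ℕ) ≤ (p : ℕ) → w i = 0) ∧ ∑ i, w i ^ 2 = 1}

/-- The inclusion `(x₀, …, x_p, r) ↦ x₀ e₀ + ⋯ + x_p e_p + r w` of the slice through `w`. -/
def slicePoint (p : Fin 7) (w : Octonion) (x : SliceSpace p) : Octonion :=
  ∑ i : Fin ((p : ℕ) + 1), x i.castSucc • Octonion.e (Fin.castLE (by omega) i)
    + x (Fin.last _) • w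

/-- `Ω_w = Ω ∩ (ℝᵖ⁺¹ ⊕ w ℝ)`, as a subset of `ℝᵖ⁺²`. -/
def sliceOf (p : Fin 7) (w : Octonion) (Ω : Set Octonion) : Set (SliceSpace p) :=
  slicePoint p w ⁻¹' Ω

/-- The partial derivative of `F` in the `i`-th coordinate at `x`. -/
def partialD {p : Fin 7} (i : Fin ((p : ℕ) + 2)) (F : SliceSpace p → Octonion)
    (x : SliceSpace p) : Octonion :=
  fderiv ℝ F x (EuclideanSpace.single i 1)

/-- The operator `D_w F = ∑_{i ≤ p} eᵢ ∂F/∂xᵢ + w ∂F/∂r`. -/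
def sliceDirac (p : Fin 7) (w : Octonion) (F : SliceSpace p → Octonion)
    (x : SliceSpace p) : Octonion :=
  ∑ i : Fin ((p : ℕ) + 1),
      Octonion.mul (Octonion.e (Fin.castLE (by omega) i)) (partialD i.castSucc F x)
    + Octonion.mul w (partialD (Fin.last _) F x)

/-- The restriction `f_w` of `f` to `Ω_w` is of class `C¹` and `D_w f_w = 0` on `Ω_w`.
Only the values of `f` on the slice `Ω_w` matter. -/
def IsMonogenicOnSlice (p : Fin 7) (w : Octonion) (Ω : Set Octonion)
    (f : Octonion → Octonion) : Prop :=
  ContDiffOn ℝ 1 (f ∘ slicePoint p w) (sliceOf p w Ω) ∧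
    ∀ x ∈ sliceOf p w Ω, sliceDirac p w (f ∘ slicePoint p w) x = 0

/-- `f` is (left) generalized partial-slice monogenic of type `p` on `Ω`. -/
def IsGSM (p : Fin 7) (Ω : Set Octonion) (f : Octonion → Octonion) : Prop :=
  ∀ w ∈ imagSphere p, IsMonogenicOnSlice p w Ω f

/-- A domain: a nonempty connected open set. -/
def IsDomainSet {E : Type*} [TopologicalSpace E] (Ω : Set E) : Prop :=
  IsOpen Ω ∧ IsConnected Ω

/-- A slice domain: a domain which meets `ℝᵖ⁺¹` and all of whose slices are domains. -/
def IsSliceDomain (p : Fin 7) (Ω : Set Octonion) : Prop :=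
  IsDomainSet Ω ∧ (Ω ∩ paravectors p).Nonempty ∧
    ∀ w ∈ imagSphere p, IsDomainSet (sliceOf p w Ω)

/-- `ι` is a smooth immersion of the manifold `M` of dimension `p + 1` into the slice space
`ℝᵖ⁺²`. The inclusion of an embedded submanifold is an example. -/
def IsSmoothHypersurface (p : Fin 7) {M : Type*} [TopologicalSpace M]
    [ChartedSpace (EuclideanSpace ℝ (Fin ((p : ℕ) + 1))) M] (ι : M → SliceSpace p) : Prop :=
  ContMDiff (𝓡 ((p : ℕ) + 1)) (𝓡 ((p : ℕ) + 2)) ∞ ι ∧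
    ∀ m : M, Function.Injective (mfderiv (𝓡 ((p : ℕ) + 1)) (𝓡 ((p : ℕ) + 2)) ι m)

end

/-! The symbol `A` of `D_ω` at ξ is left multiplication by the octonion corresponding to ξ. Since
the octonion norm is multiplicative, |A(ξ)u| = |ξ||u|. This is the only algebra needed: the core is
unique continuation for constant-coefficient first-order systems with this property, and it uses
neither associativity nor power series.

Applying A(x)† factors the operator: A(x)†D = E + Γ, with E the Euler field and Γ an angular
operator. In L², E + n/2 is skew, Γ is symmetric, and the two commute; this yields the Carleman
inequality `carleman_inequality`. With the weight exp(τ/|x|²) and τ → ∞, a C² solution vanishing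
near the centre of a ball vanishes on smaller concentric balls (`eq_zero_on_ball_of_cutoff`).
Mollification brings this to C¹ solutions, and connectedness spreads it over a domain
(`eq_zero_of_eventuallyEq_zero`).

If f vanishes on an immersed hypersurface, its tangential derivatives vanish there, so the equation
reduces to A(ν)∂_ν f = 0 and the whole gradient vanishes. Replacing f by 0 on one side of the
hypersurface therefore gives another C¹ solution. It vanishes on an open set, hence identically, so
f is zero on the other side as well (`eq_zero_of_eq_zero_on_immersion`).

All slices of Ω share Ω ∩ ℝᵖ⁺¹, which is a nonempty hypersurface in each of them. Vanishing thus
passes from one slice to every other, and the slices cover Ω. Equality of two functions reduces to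
vanishing of their difference. -/

open MeasureTheory InnerProductSpace Filter Topology

noncomputable section

/-! ### Integration by parts for the Euler and angular operators -/

namespace CliffordSymbol

variable {n : ℕ} {V : Type*} [NormedAddCommGroup V] [InnerProductSpace ℝ V]

local notation "𝔼" => EuclideanSpace ℝ (Fin n)

/-- The standard basis vectors. -/
abbrev basisVec (i : Fin n) : EuclideanSpace ℝ (Fin n) := EuclideanSpace.single i 1

theorem sum_smul_basisVec (x : 𝔼) : ∑ i, x i • basisVec i = x := by
  ext j
  simp [Pi.single_apply]

theorem clm_apply_eq_sum {W : Type*} [NormedAddCommGroup W] [NormedSpace ℝ W] (L : 𝔼 →L[ℝ] W)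
    (x : 𝔼) : L x = ∑ i, x i • L (basisVec i) := by
  conv_lhs => rw [← sum_smul_basisVec x]
  simp only [map_sum, map_smul]

theorem integral_coord_mul_fderiv (k : 𝔼 → ℝ) (hk : ContDiff ℝ 1 k)
    (hc : HasCompactSupport k) (i j : Fin n) :
    ∫ x : 𝔼, x j * fderiv ℝ k x (basisVec i) = - if i = j then ∫ x, k x else 0 := by
  have hd : Continuous fun x => fderiv ℝ k x (basisVec i) :=
    (hk.continuous_fderiv one_ne_zero).clm_apply continuous_const
  have hdc : HasCompactSupport fun x => fderiv ℝ k x (basisVec i) := hc.fderiv_apply ℝ (basisVec i)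
  have hcoord : ∀ x : 𝔼, fderiv ℝ (fun x : 𝔼 => x j) x = EuclideanSpace.proj j := fun x =>
    (EuclideanSpace.proj (𝕜 := ℝ) j).fderiv
  have hcont : Continuous fun x : 𝔼 => x j := (EuclideanSpace.proj (𝕜 := ℝ) j).continuous
  rw [integral_mul_fderiv_eq_neg_fderiv_mul_of_integrable (f := fun x : 𝔼 => x j) (g := k)]
  · simp only [hcoord]
    by_cases h : i = j
    · subst h; simp [basisVec]
    · have : j ≠ i := fun h' => h h'.symm
      simp [basisVec, h, this]
  · simp only [hcoord]
    exact (continuous_const.mul hk.continuous).integrable_of_hasCompactSupport hc.mul_left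
  · exact (hcont.mul hd).integrable_of_hasCompactSupport hdc.mul_left
  · exact (hcont.mul hk.continuous).integrable_of_hasCompactSupport hc.mul_left
  · exact fun x _ => (EuclideanSpace.proj (𝕜 := ℝ) j).differentiableAt
  · exact fun x _ => (hk.differentiable one_ne_zero).differentiableAt

theorem continuous_fderiv_basisVec {W : Type*} [NormedAddCommGroup W] [NormedSpace ℝ W]
    {v : 𝔼 → W} (hv : ContDiff ℝ 1 v) (i : Fin n) :
    Continuous fun x => fderiv ℝ v x (basisVec i) :=
  (hv.continuous_fderiv one_ne_zero).clm_apply continuous_const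

theorem continuous_coord (j : Fin n) : Continuous fun x : 𝔼 => x j :=
  (EuclideanSpace.proj (𝕜 := ℝ) j).continuous

theorem integral_euler (k : 𝔼 → ℝ) (hk : ContDiff ℝ 1 k) (hc : HasCompactSupport k) :
    ∫ x : 𝔼, fderiv ℝ k x x = - (n * ∫ x, k x) := by
  have : ∀ x : 𝔼, fderiv ℝ k x x = ∑ i, x i * fderiv ℝ k x (basisVec i) := fun x => by
    rw [clm_apply_eq_sum]; simp
  simp only [this]
  rw [integral_finsetSum]
  · simp [integral_coord_mul_fderiv k hk hc]
  · intro i _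
    exact ((continuous_coord i).mul (continuous_fderiv_basisVec hk i)).integrable_of_hasCompactSupport
      (hc.fderiv_apply ℝ (basisVec i)).mul_left

theorem fderiv_inner_euclidean {u w : 𝔼 → V} (hu : ContDiff ℝ 1 u) (hw : ContDiff ℝ 1 w) (x y : 𝔼) :
    fderiv ℝ (fun x => inner ℝ (u x) (w x)) x y
      = inner ℝ (u x) (fderiv ℝ w x y) + inner ℝ (fderiv ℝ u x y) (w x) :=
  fderiv_inner_apply ℝ (hu.differentiable one_ne_zero x) (hw.differentiable one_ne_zero x) y

/-- The first order operator `∑ xⱼ Gⱼᵢ ∂ᵢ`. -/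
def angular (G : Fin n → Fin n → V →L[ℝ] V) (v : 𝔼 → V) (x : 𝔼) : V :=
  ∑ j, ∑ i, x j • G j i (fderiv ℝ v x (basisVec i))

/-- The sign from integrating by parts cancels the sign from skewness of `G j i`. The derivative of
the coefficient `x j` contributes only for `i = j`, where `G i i = 0`. -/
theorem integral_inner_angular (G : Fin n → Fin n → V →L[ℝ] V)
    (hG : ∀ j i a b, inner ℝ (G j i a) b = - inner ℝ a (G j i b)) (hG0 : ∀ i, G i i = 0)
    {u w : 𝔼 → V} (hu : ContDiff ℝ 1 u) (hw : ContDiff ℝ 1 w)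
    (huc : HasCompactSupport u) :
    ∫ x, inner ℝ (angular G u x) (w x) = ∫ x, inner ℝ (u x) (angular G w x) := by
  have hk : ∀ j i, ContDiff ℝ 1 fun x => inner ℝ (u x) (G j i (w x)) := fun j i =>
    hu.inner ℝ ((G j i).contDiff.comp hw)
  have hkc : ∀ j i, HasCompactSupport fun x => inner ℝ (u x) (G j i (w x)) := fun j i =>
    huc.mono fun x hx => by
      contrapose! hx
      simp only [Function.mem_support, not_not] at hx ⊢
      simp [hx]
  have hfd : ∀ j i x y, fderiv ℝ (fun x => inner ℝ (u x) (G j i (w x))) x y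
      = inner ℝ (u x) (G j i (fderiv ℝ w x y)) + inner ℝ (fderiv ℝ u x y) (G j i (w x)) := by
    intro j i x y
    have hin := fderiv_inner_euclidean hu ((G j i).contDiff.comp hw) x y
    simp only [Function.comp_apply] at hin
    rw [hin]
    congr 2
    have : HasFDerivAt (fun x => G j i (w x)) ((G j i).comp (fderiv ℝ w x)) x :=
      (G j i).hasFDerivAt.comp x (hw.differentiable one_ne_zero x).hasFDerivAt
    rw [show (⇑(G j i) ∘ w) = fun x => G j i (w x) from rfl, this.fderiv]
    rfl
  have key : ∀ x, inner ℝ (u x) (angular G w x) - inner ℝ (angular G u x) (w x)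
      = ∑ j, ∑ i, x j * fderiv ℝ (fun x => inner ℝ (u x) (G j i (w x))) x (basisVec i) := by
    intro x
    simp only [angular, inner_sum, sum_inner, inner_smul_left, inner_smul_right, hfd, hG,
      ← Finset.sum_sub_distrib]
    refine Finset.sum_congr rfl fun j _ => Finset.sum_congr rfl fun i _ => ?_
    simp only [conj_trivial]; ring
  have hcontA : ∀ {v : 𝔼 → V}, ContDiff ℝ 1 v → Continuous (angular G v) := by
    intro v hv
    unfold angular
    exact continuous_finsetSum _ fun j _ => continuous_finsetSum _ fun i _ =>
      (continuous_coord j).smul ((G j i).continuous.comp (continuous_fderiv_basisVec hv i))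
  have hi1 : Integrable fun x => inner ℝ (u x) (angular G w x) :=
    (hu.continuous.inner (hcontA hw)).integrable_of_hasCompactSupport <|
      huc.mono fun x hx => by
        contrapose! hx
        simp only [Function.mem_support, not_not] at hx ⊢
        simp [hx]
  have hi2 : Integrable fun x => inner ℝ (angular G u x) (w x) :=
    ((hcontA hu).inner hw.continuous).integrable_of_hasCompactSupport <|
      (huc.fderiv ℝ).mono fun x hx => by
        contrapose! hx
        simp only [Function.mem_support, not_not] at hx ⊢
        simp [angular, hx]
  have h0 : ∫ x, (inner ℝ (u x) (angular G w x) - inner ℝ (angular G u x) (w x)) = 0 := by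
    simp only [key]
    have hint : ∀ j i, Integrable fun x : 𝔼 =>
        x j * fderiv ℝ (fun x => inner ℝ (u x) (G j i (w x))) x (basisVec i) := fun j i =>
      ((continuous_coord j).mul (continuous_fderiv_basisVec (hk j i) i)).integrable_of_hasCompactSupport
        ((hkc j i).fderiv_apply ℝ (basisVec i)).mul_left
    rw [integral_finsetSum _ fun j _ => integrable_finsetSum _ fun i _ => hint j i]
    refine Finset.sum_eq_zero fun j _ => ?_
    rw [integral_finsetSum _ fun i _ => hint j i]
    refine Finset.sum_eq_zero fun i _ => ?_
    rw [integral_coord_mul_fderiv _ (hk j i) (hkc j i)]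
    split_ifs with h
    · subst h; simp [hG0]
    · simp
  rw [integral_sub hi1 hi2] at h0
  linarith

/-- The Euler field has divergence n; the shift by n/2 is what makes it skew in L². -/
theorem integral_inner_euler {u w : 𝔼 → V} (hu : ContDiff ℝ 1 u) (hw : ContDiff ℝ 1 w)
    (huc : HasCompactSupport u) (hwc : HasCompactSupport w) :
    ∫ x, inner ℝ (fderiv ℝ u x x + (n / 2 : ℝ) • u x) (w x)
      = - ∫ x, inner ℝ (u x) (fderiv ℝ w x x + (n / 2 : ℝ) • w x) := by
  have hk : ContDiff ℝ 1 fun x => inner ℝ (u x) (w x) := hu.inner ℝ hw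
  have hkc : HasCompactSupport fun x => inner ℝ (u x) (w x) :=
    huc.mono fun x hx => by
      contrapose! hx
      simp only [Function.mem_support, not_not] at hx ⊢
      simp [hx]
  have he : ∀ {v : 𝔼 → V}, ContDiff ℝ 1 v → Continuous fun x => fderiv ℝ v x x + (n / 2 : ℝ) • v x :=
    fun hv => ((hv.continuous_fderiv one_ne_zero).clm_apply continuous_id).add
      (hv.continuous.const_smul _)
  have hi1 : Integrable fun x => inner ℝ (fderiv ℝ u x x + (n / 2 : ℝ) • u x) (w x) :=
    ((he hu).inner hw.continuous).integrable_of_hasCompactSupport <|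
      hwc.mono fun x hx => by
        contrapose! hx
        simp only [Function.mem_support, not_not] at hx ⊢
        simp [hx]
  have hi2 : Integrable fun x => inner ℝ (u x) (fderiv ℝ w x x + (n / 2 : ℝ) • w x) :=
    (hu.continuous.inner (he hw)).integrable_of_hasCompactSupport <|
      huc.mono fun x hx => by
        contrapose! hx
        simp only [Function.mem_support, not_not] at hx ⊢
        simp [hx]
  rw [eq_neg_iff_add_eq_zero, ← integral_add hi1 hi2]
  have : ∀ x, inner ℝ (fderiv ℝ u x x + (n / 2 : ℝ) • u x) (w x)
      + inner ℝ (u x) (fderiv ℝ w x x + (n / 2 : ℝ) • w x)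
      = fderiv ℝ (fun x => inner ℝ (u x) (w x)) x x + n * inner ℝ (u x) (w x) := by
    intro x
    rw [fderiv_inner_euclidean hu hw]
    simp only [inner_add_left, inner_add_right, inner_smul_left, inner_smul_right, conj_trivial]
    ring
  simp only [this]
  rw [integral_add, integral_euler _ hk hkc, integral_const_mul]
  · ring
  · refine ((hk.continuous_fderiv one_ne_zero).clm_apply
      continuous_id).integrable_of_hasCompactSupport ((hkc.fderiv ℝ).mono fun x hx => ?_)
    contrapose! hx
    simp only [Function.mem_support, not_not] at hx ⊢
    simp [hx]
  · exact (hk.continuous.integrable_of_hasCompactSupport hkc).const_mul _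

theorem fderiv_euler {v : 𝔼 → V} (hv : ContDiff ℝ 2 v) (x y : 𝔼) :
    fderiv ℝ (fun x => fderiv ℝ v x x) x y = fderiv ℝ (fderiv ℝ v) x y x + fderiv ℝ v x y := by
  have h1 : HasFDerivAt (fderiv ℝ v) (fderiv ℝ (fderiv ℝ v) x) x :=
    ((hv.fderiv_right (m := 1) (by norm_num)).differentiable one_ne_zero x).hasFDerivAt
  have h2 : HasFDerivAt (fun x => fderiv ℝ v x x) _ x := h1.clm_apply (hasFDerivAt_id x)
  rw [h2.fderiv]
  simp [add_comm]

/-- The angular operator is homogeneous of degree zero, so it commutes with the Euler field. The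
second-order terms agree by symmetry of the second derivative. -/
theorem fderiv_angular_self (G : Fin n → Fin n → V →L[ℝ] V) {v : 𝔼 → V} (hv : ContDiff ℝ 2 v)
    (x : 𝔼) :
    fderiv ℝ (angular G v) x x = angular G (fun x => fderiv ℝ v x x) x := by
  have hc : ContDiff ℝ 1 (fderiv ℝ v) := hv.fderiv_right (m := 1) (by norm_num)
  have h1 : HasFDerivAt (fderiv ℝ v) (fderiv ℝ (fderiv ℝ v) x) x :=
    (hc.differentiable one_ne_zero x).hasFDerivAt
  have hsymm : ∀ y z, fderiv ℝ (fderiv ℝ v) x y z = fderiv ℝ (fderiv ℝ v) x z y :=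
    fun y z => (hv.contDiffAt.isSymmSndFDerivAt (by simp)).eq y z
  have hterm : ∀ j i, HasFDerivAt (fun x : 𝔼 => x j • G j i (fderiv ℝ v x (basisVec i)))
      (x j • ((G j i).comp ((ContinuousLinearMap.apply ℝ V (basisVec i)).comp
        (fderiv ℝ (fderiv ℝ v) x)))
        + (EuclideanSpace.proj (𝕜 := ℝ) j : 𝔼 →L[ℝ] ℝ).smulRight
          (G j i (fderiv ℝ v x (basisVec i)))) x := by
    intro j i
    exact (EuclideanSpace.proj (𝕜 := ℝ) j : 𝔼 →L[ℝ] ℝ).hasFDerivAt.smul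
      ((G j i).hasFDerivAt.comp x
        ((ContinuousLinearMap.apply ℝ V (basisVec i)).hasFDerivAt.comp x h1))
  have hsum : HasFDerivAt (angular G v) _ x :=
    HasFDerivAt.fun_sum (u := Finset.univ) fun j _ =>
      HasFDerivAt.fun_sum (u := Finset.univ) fun i _ => hterm j i
  rw [hsum.fderiv]
  simp only [angular, fderiv_euler hv, _root_.sum_apply]
  refine Finset.sum_congr rfl fun j _ => Finset.sum_congr rfl fun i _ => ?_
  simp [hsymm x (basisVec i)]

theorem contDiff_angular (G : Fin n → Fin n → V →L[ℝ] V) {v : 𝔼 → V} (hv : ContDiff ℝ 2 v) :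
    ContDiff ℝ 1 (angular G v) := by
  have hc : ContDiff ℝ 1 (fderiv ℝ v) := hv.fderiv_right (m := 1) (by norm_num)
  unfold angular
  exact ContDiff.sum fun j _ => ContDiff.sum fun i _ =>
    (EuclideanSpace.proj (𝕜 := ℝ) j : 𝔼 →L[ℝ] ℝ).contDiff.smul
      ((G j i).contDiff.comp (hc.clm_apply contDiff_const))

theorem contDiff_euler {v : 𝔼 → V} (hv : ContDiff ℝ 2 v) :
    ContDiff ℝ 1 fun x => fderiv ℝ v x x :=
  (hv.fderiv_right (m := 1) (by norm_num)).clm_apply contDiff_id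

theorem hasCompactSupport_euler {v : 𝔼 → V} (hv : HasCompactSupport v) :
    HasCompactSupport fun x => fderiv ℝ v x x :=
  (hv.fderiv ℝ).mono fun x hx => by
    contrapose! hx
    simp only [Function.mem_support, not_not] at hx ⊢
    simp [hx]

theorem hasCompactSupport_angular (G : Fin n → Fin n → V →L[ℝ] V) {v : 𝔼 → V}
    (hv : HasCompactSupport v) : HasCompactSupport (angular G v) :=
  (hv.fderiv ℝ).mono fun x hx => by
    contrapose! hx
    simp only [Function.mem_support, not_not] at hx ⊢
    simp [angular, hx]

/-- With S = E + n/2 skew, Γ symmetric and SΓ = ΓS, one gets ⟨Sv, Γv⟩ = -⟨v, ΓSv⟩ = -⟨Γv, Sv⟩. -/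
theorem integral_inner_euler_angular (G : Fin n → Fin n → V →L[ℝ] V)
    (hG : ∀ j i a b, inner ℝ (G j i a) b = - inner ℝ a (G j i b)) (hG0 : ∀ i, G i i = 0)
    {v : 𝔼 → V} (hv : ContDiff ℝ 2 v) (hvc : HasCompactSupport v) :
    ∫ x, inner ℝ (fderiv ℝ v x x + (n / 2 : ℝ) • v x) (angular G v x) = 0 := by
  have hv1 : ContDiff ℝ 1 v := hv.of_le (by norm_num)
  have h1 := integral_inner_euler hv1 (contDiff_angular G hv) hvc (hasCompactSupport_angular G hvc)
  have hE : ContDiff ℝ 1 fun x => fderiv ℝ v x x + (n / 2 : ℝ) • v x :=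
    (contDiff_euler hv).add (hv1.const_smul _)
  have hcomm : ∀ x, fderiv ℝ (angular G v) x x + (n / 2 : ℝ) • angular G v x
      = angular G (fun x => fderiv ℝ v x x + (n / 2 : ℝ) • v x) x := by
    intro x
    rw [fderiv_angular_self G hv]
    have hadd : ∀ y, fderiv ℝ (fun x => fderiv ℝ v x x + (n / 2 : ℝ) • v x) x y
        = fderiv ℝ (fun x => fderiv ℝ v x x) x y + (n / 2 : ℝ) • fderiv ℝ v x y := fun y => by
      have hs : HasFDerivAt (fun x => fderiv ℝ v x x + (n / 2 : ℝ) • v x) _ x :=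
        ((contDiff_euler hv).differentiable one_ne_zero x).hasFDerivAt.add
          ((hv1.differentiable one_ne_zero x).hasFDerivAt.const_smul (n / 2 : ℝ))
      rw [hs.fderiv]
      rfl
    simp only [angular, hadd, map_add, map_smul, smul_add, Finset.sum_add_distrib, Finset.smul_sum]
    simp only [smul_comm (n / 2 : ℝ)]
  simp only [hcomm] at h1
  rw [← integral_inner_angular G hG hG0 hv1 hE hvc] at h1
  simp only [real_inner_comm (angular G v _)] at h1
  have h2 : ∀ x, inner ℝ (angular G v x) (fderiv ℝ v x x + (n / 2 : ℝ) • v x)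
    = inner ℝ (fderiv ℝ v x x + (n / 2 : ℝ) • v x) (angular G v x) := fun x => real_inner_comm _ _
  simp only [h2] at h1
  linarith

end CliffordSymbol

/-! ### The Carleman inequality -/

namespace CliffordSymbol

variable {n : ℕ} {V : Type*} [NormedAddCommGroup V] [InnerProductSpace ℝ V]

local notation "𝔼" => EuclideanSpace ℝ (Fin n)

/-- A Carleman inequality for the operator `x ↦ ∑ xⱼ Cⱼᵢ ∂ᵢ`, split into its Euler and angular
parts. -/
theorem carleman_inequality (G : Fin n → Fin n → V →L[ℝ] V)
    (hG : ∀ j i a b, inner ℝ (G j i a) b = - inner ℝ a (G j i b)) (hG0 : ∀ i, G i i = 0)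
    {v : 𝔼 → V} (hv : ContDiff ℝ 2 v) (hvc : HasCompactSupport v)
    {h : 𝔼 → ℝ} (hh : ContDiff ℝ 1 h) :
    2 * ∫ x, fderiv ℝ h x x * ‖v x‖ ^ 2
      ≤ ∫ x, ‖fderiv ℝ v x x + angular G v x + (n / 2 - h x : ℝ) • v x‖ ^ 2 := by
  have hv1 : ContDiff ℝ 1 v := hv.of_le (by norm_num)
  have hE := contDiff_euler hv
  have hEc := hasCompactSupport_euler hvc
  have hΓ := contDiff_angular G hv
  have hΓc := hasCompactSupport_angular G hvc
  have hE' : ContDiff ℝ 1 fun x => fderiv ℝ v x x + (n / 2 : ℝ) • v x := hE.add (hv1.const_smul _)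
  have h0 := integral_inner_euler_angular G hG hG0 hv hvc
  have hk : ContDiff ℝ 1 fun x => h x * ‖v x‖ ^ 2 := hh.mul (hv1.norm_sq ℝ)
  have hnc : HasCompactSupport fun x => ‖v x‖ ^ 2 := hvc.mono fun x hx => by
    contrapose! hx
    simp only [Function.mem_support, not_not] at hx ⊢
    simp [hx]
  have hkc : HasCompactSupport fun x => h x * ‖v x‖ ^ 2 := hnc.mul_left
  have he := integral_euler _ hk hkc
  have hkd : ∀ x, fderiv ℝ (fun x => h x * ‖v x‖ ^ 2) x x
      = fderiv ℝ h x x * ‖v x‖ ^ 2 + 2 * h x * inner ℝ (fderiv ℝ v x x) (v x) := by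
    intro x
    have h1 : HasFDerivAt (fun x => h x * ‖v x‖ ^ 2) _ x :=
      (hh.differentiable one_ne_zero x).hasFDerivAt.mul
        (hv1.differentiable one_ne_zero x).hasFDerivAt.norm_sq
    rw [h1.fderiv]
    simp [real_inner_comm (v x)]
    ring
  have hi1 : Integrable fun x => inner ℝ (fderiv ℝ v x x + (n / 2 : ℝ) • v x) (angular G v x) :=
    (hE'.continuous.inner hΓ.continuous).integrable_of_hasCompactSupport <|
      hΓc.mono fun x hx => by
        contrapose! hx
        simp only [Function.mem_support, not_not] at hx ⊢
        simp [hx]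
  have hi2 : Integrable fun x => h x * ‖v x‖ ^ 2 := hk.continuous.integrable_of_hasCompactSupport hkc
  have hi3 : Integrable fun x => fderiv ℝ h x x * ‖v x‖ ^ 2 :=
    (((hh.continuous_fderiv one_ne_zero).clm_apply continuous_id).mul
      (hv1.norm_sq ℝ).continuous).integrable_of_hasCompactSupport hnc.mul_left
  have hi4 : Integrable fun x => fderiv ℝ (fun x => h x * ‖v x‖ ^ 2) x x :=
    ((hk.continuous_fderiv one_ne_zero).clm_apply
      continuous_id).integrable_of_hasCompactSupport (hasCompactSupport_euler hkc)
  -- This is ‖a + b‖² ≥ 4⟨a, b⟩ for the skew part a = (E + n/2)v and the symmetric part b = (Γ -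
  -- h)v. After integration the Γ term drops out, and the h terms leave 2∫(Eh)|v|².
  have hpt : ∀ x, 4 * inner ℝ (fderiv ℝ v x x + (n / 2 : ℝ) • v x) (angular G v x)
      - 2 * fderiv ℝ (fun x => h x * ‖v x‖ ^ 2) x x - 2 * n * (h x * ‖v x‖ ^ 2)
      + 2 * (fderiv ℝ h x x * ‖v x‖ ^ 2)
      ≤ ‖fderiv ℝ v x x + angular G v x + (n / 2 - h x : ℝ) • v x‖ ^ 2 := by
    intro x
    have hsplit : fderiv ℝ v x x + angular G v x + (n / 2 - h x : ℝ) • v x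
        = (fderiv ℝ v x x + (n / 2 : ℝ) • v x) + (angular G v x - h x • v x) := by
      rw [sub_smul]; abel
    have hsq : 4 * inner ℝ (fderiv ℝ v x x + (n / 2 : ℝ) • v x) (angular G v x - h x • v x)
        ≤ ‖(fderiv ℝ v x x + (n / 2 : ℝ) • v x) + (angular G v x - h x • v x)‖ ^ 2 := by
      rw [norm_add_sq_real]
      have := norm_sub_sq_real (fderiv ℝ v x x + (n / 2 : ℝ) • v x) (angular G v x - h x • v x)
      nlinarith [sq_nonneg ‖(fderiv ℝ v x x + (n / 2 : ℝ) • v x) - (angular G v x - h x • v x)‖]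
    rw [hsplit]
    refine le_trans (le_of_eq ?_) hsq
    rw [hkd]
    simp only [inner_sub_right, inner_add_left, inner_smul_left, inner_smul_right, conj_trivial,
      real_inner_self_eq_norm_sq]
    ring
  have hi5 : Integrable fun x => ‖fderiv ℝ v x x + angular G v x + (n / 2 - h x : ℝ) • v x‖ ^ 2 := by
    refine Continuous.integrable_of_hasCompactSupport ?_ ?_
    · exact ((hE.continuous.add hΓ.continuous).add
        ((continuous_const.sub hh.continuous).smul hv.continuous)).norm.pow 2
    · have := (hEc.add hΓc).add (hvc.smul_left (f := fun x => (n / 2 - h x : ℝ)))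
      refine this.mono fun x hx => ?_
      contrapose! hx
      simp only [Function.mem_support, not_not] at hx ⊢
      have hx' : fderiv ℝ v x x + angular G v x + (n / 2 - h x : ℝ) • v x = 0 := hx
      simp [hx']
  have hmono := integral_mono
    ((((hi1.const_mul 4).sub (hi4.const_mul 2)).sub (hi2.const_mul (2 * n))).add (hi3.const_mul 2))
    hi5 hpt
  refine le_trans (le_of_eq ?_) hmono
  rw [integral_add' (((hi1.const_mul 4).sub (hi4.const_mul 2)).sub (hi2.const_mul (2 * n)))
    (hi3.const_mul 2), integral_sub' ((hi1.const_mul 4).sub (hi4.const_mul 2))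
    (hi2.const_mul (2 * n)), integral_sub' (hi1.const_mul 4) (hi4.const_mul 2)]
  simp only [integral_const_mul]
  rw [h0, he]
  ring

end CliffordSymbol

/-! ### Norm-multiplicative symbols and the factorization of the Dirac operator -/

namespace CliffordSymbol

variable {n : ℕ} {V : Type*} [NormedAddCommGroup V] [InnerProductSpace ℝ V]

local notation "𝔼" => EuclideanSpace ℝ (Fin n)

/-- The Dirac type operator `∑ A(eᵢ) ∂ᵢ` with symbol `A`. -/
def dirac (A : EuclideanSpace ℝ (Fin n) →L[ℝ] V →L[ℝ] V) (f : EuclideanSpace ℝ (Fin n) → V)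
    (x : EuclideanSpace ℝ (Fin n)) : V :=
  ∑ i, A (basisVec i) (fderiv ℝ f x (basisVec i))

theorem inner_symbol_self {A : 𝔼 →L[ℝ] V →L[ℝ] V} (hA : ∀ x u, ‖A x u‖ = ‖x‖ * ‖u‖)
    (x : 𝔼) (u w : V) : inner ℝ (A x u) (A x w) = ‖x‖ ^ 2 * inner ℝ u w := by
  have h := hA x (u + w)
  have h2 : ‖A x (u + w)‖ ^ 2 = (‖x‖ * ‖u + w‖) ^ 2 := by rw [h]
  rw [map_add, mul_pow, norm_add_sq_real, norm_add_sq_real, hA, hA] at h2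
  linear_combination h2 / 2

/-- Polarization in both arguments turns `hA` into the Clifford relation A(x)†A(y) + A(y)†A(x) =
2⟨x, y⟩. -/
theorem inner_symbol_add {A : 𝔼 →L[ℝ] V →L[ℝ] V} (hA : ∀ x u, ‖A x u‖ = ‖x‖ * ‖u‖)
    (x y : 𝔼) (u w : V) :
    inner ℝ (A x u) (A y w) + inner ℝ (A y u) (A x w) = 2 * inner ℝ x y * inner ℝ u w := by
  have h := inner_symbol_self hA (x + y) u w
  rw [map_add, norm_add_sq_real] at h
  simp only [_root_.add_apply, inner_add_left, inner_add_right] at h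
  rw [inner_symbol_self hA, inner_symbol_self hA] at h
  linear_combination h

variable [CompleteSpace V]

/-- The operators `A(eⱼ)† A(eᵢ) - δⱼᵢ`. -/
def angularSymbol (A : EuclideanSpace ℝ (Fin n) →L[ℝ] V →L[ℝ] V) (j i : Fin n) : V →L[ℝ] V :=
  ((A (basisVec j)).adjoint).comp (A (basisVec i))
    - if j = i then ContinuousLinearMap.id ℝ V else 0

theorem inner_basisVec (i j : Fin n) :
    inner ℝ (basisVec i) (basisVec j) = if i = j then (1 : ℝ) else 0 := by
  by_cases h : i = j
  · subst h; simp [basisVec]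
  · simp [basisVec, EuclideanSpace.inner_single_left, h]

theorem inner_angularSymbol {A : 𝔼 →L[ℝ] V →L[ℝ] V} (hA : ∀ x u, ‖A x u‖ = ‖x‖ * ‖u‖)
    (j i : Fin n) (u w : V) :
    inner ℝ (angularSymbol A j i u) w = - inner ℝ u (angularSymbol A j i w) := by
  have h := inner_symbol_add hA (basisVec i) (basisVec j) u w
  rw [inner_basisVec] at h
  have e1 : inner ℝ (((A (basisVec j)).adjoint) (A (basisVec i) u)) w
      = inner ℝ (A (basisVec i) u) (A (basisVec j) w) :=
    ContinuousLinearMap.adjoint_inner_left _ _ _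
  have e2 : inner ℝ u (((A (basisVec j)).adjoint) (A (basisVec i) w))
      = inner ℝ (A (basisVec j) u) (A (basisVec i) w) :=
    ContinuousLinearMap.adjoint_inner_right _ _ _
  by_cases hij : j = i
  · subst hij
    simp only [angularSymbol, if_true, _root_.sub_apply,
      ContinuousLinearMap.comp_apply, ContinuousLinearMap.id_apply, inner_sub_left,
      inner_sub_right, e1, e2] at h ⊢
    linarith
  · have hij' : ¬ i = j := fun h => hij h.symm
    simp only [angularSymbol, hij, hij', if_false, sub_zero,
      ContinuousLinearMap.comp_apply, e1, e2] at h ⊢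
    linarith

theorem adjoint_symbol_apply_self {A : 𝔼 →L[ℝ] V →L[ℝ] V} (hA : ∀ x u, ‖A x u‖ = ‖x‖ * ‖u‖)
    (x : 𝔼) (u : V) : (A x).adjoint (A x u) = ‖x‖ ^ 2 • u := by
  refine ext_inner_right ℝ fun w => ?_
  rw [ContinuousLinearMap.adjoint_inner_left, inner_symbol_self hA, inner_smul_left]
  simp

theorem angularSymbol_self {A : 𝔼 →L[ℝ] V →L[ℝ] V} (hA : ∀ x u, ‖A x u‖ = ‖x‖ * ‖u‖)
    (i : Fin n) : angularSymbol A i i = 0 := by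
  ext u
  simp [angularSymbol, adjoint_symbol_apply_self hA]

theorem adjoint_symbol_eq_sum (A : 𝔼 →L[ℝ] V →L[ℝ] V) (x : 𝔼) (w : V) :
    (A x).adjoint w = ∑ j, x j • (A (basisVec j)).adjoint w := by
  refine ext_inner_right ℝ fun u => ?_
  rw [ContinuousLinearMap.adjoint_inner_left, clm_apply_eq_sum A x]
  simp only [sum_inner, inner_smul_left, ContinuousLinearMap.adjoint_inner_left,
    _root_.sum_apply, _root_.smul_apply, inner_sum, inner_smul_right, conj_trivial]

/-- Expand A(x)†D as ∑ xⱼ A(eⱼ)†A(eᵢ)∂ᵢ; the δⱼᵢ removed in `angularSymbol` is exactly the Euler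
field. -/
theorem euler_add_angular (A : 𝔼 →L[ℝ] V →L[ℝ] V) (v : 𝔼 → V) (x : 𝔼) :
    fderiv ℝ v x x + angular (angularSymbol A) v x = (A x).adjoint (dirac A v x) := by
  rw [adjoint_symbol_eq_sum]
  have h1 : fderiv ℝ v x x = ∑ j, ∑ i, x j • (if j = i then ContinuousLinearMap.id ℝ V else 0)
      (fderiv ℝ v x (basisVec i)) := by
    rw [clm_apply_eq_sum]
    refine Finset.sum_congr rfl fun j _ => ?_
    rw [Finset.sum_eq_single j]
    · simp
    · intro i _ hij; simp [hij.symm]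
    · simp
  rw [h1, angular, ← Finset.sum_add_distrib]
  refine Finset.sum_congr rfl fun j _ => ?_
  rw [← Finset.sum_add_distrib, dirac, map_sum, Finset.smul_sum]
  refine Finset.sum_congr rfl fun i _ => ?_
  simp [angularSymbol, ← smul_add]


end CliffordSymbol

/-! ### Vanishing of C² solutions on balls -/

namespace CliffordSymbol

variable {n : ℕ} {V : Type*} [NormedAddCommGroup V] [InnerProductSpace ℝ V]

local notation "𝔼" => EuclideanSpace ℝ (Fin n)

theorem dirac_eq_of_hasFDerivAt (A : 𝔼 →L[ℝ] V →L[ℝ] V) {f : 𝔼 → V} {f' : 𝔼 →L[ℝ] V} {x : 𝔼}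
    (hf : HasFDerivAt f f' x) : dirac A f x = ∑ i, A (basisVec i) (f' (basisVec i)) := by
  rw [dirac, hf.fderiv]

theorem dirac_congr (A : 𝔼 →L[ℝ] V →L[ℝ] V) {f g : 𝔼 → V} {x : 𝔼} (h : f =ᶠ[𝓝 x] g) :
    dirac A f x = dirac A g x := by
  rw [dirac, dirac, h.fderiv_eq]

/-- The gradient of a radial factor is a multiple of x, so the Leibniz term is a multiple of A(x),
which A(x)† then turns into a scalar. -/
theorem dirac_radial_smul (A : 𝔼 →L[ℝ] V →L[ℝ] V) {f : 𝔼 → V} {θ : 𝔼 → ℝ} {x : 𝔼} {c : ℝ}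
    (hf : DifferentiableAt ℝ f x) (hθ : HasFDerivAt θ (c • innerSL ℝ x) x) :
    dirac A (fun y => θ y • f y) x = c • A x (f x) + θ x • dirac A f x := by
  have hs : HasFDerivAt (fun y => θ y • f y) _ x := hθ.smul hf.hasFDerivAt
  rw [dirac_eq_of_hasFDerivAt A hs, dirac, clm_apply_eq_sum A x,
    Finset.smul_sum, _root_.sum_apply, Finset.smul_sum, ← Finset.sum_add_distrib]
  refine Finset.sum_congr rfl fun i _ => ?_
  simp [basisVec, EuclideanSpace.inner_single_right, smul_smul, add_comm]

theorem hasFDerivAt_norm_sq_of_eventuallyEq {Q : 𝔼 → ℝ} {x : 𝔼}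
    (hQ : Q =ᶠ[𝓝 x] fun y => ‖y‖ ^ 2) : HasFDerivAt Q ((2 : ℝ) • innerSL ℝ x) x := by
  refine HasFDerivAt.congr_of_eventuallyEq ?_ hQ
  rw [ofNat_smul_eq_nsmul]
  exact (hasStrictFDerivAt_norm_sq x).hasFDerivAt

variable [CompleteSpace V]

/-- Apply the Carleman inequality to f times a cutoff and a weight that is at least 1 on ρ ≤ |x| < a
and at most 1 for |x| ≥ a. The error lives only where the cutoff varies and is bounded independently
of τ, while the left side grows like τ∫|f|² over the ball of radius a. -/
theorem eq_zero_on_ball_of_cutoff {A : 𝔼 →L[ℝ] V →L[ℝ] V} (hA : ∀ x u, ‖A x u‖ = ‖x‖ * ‖u‖)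
    {f : 𝔼 → V} (hf : ContDiff ℝ 2 f) {ρ a b R : ℝ} (hρ : 0 < ρ) (hρa : ρ < a) (hab : a < b)
    (hbR : b < R) (hD : ∀ x, ‖x‖ < R → dirac A f x = 0) (hz : ∀ x, ‖x‖ < ρ → f x = 0)
    {x : 𝔼} (hx : ‖x‖ < a) : f x = 0 := by
  have ha : 0 < a := hρ.trans hρa
  have hb : 0 < b := ha.trans hab
  have hab2 : 0 < b ^ 2 - a ^ 2 := by nlinarith
  let s : ℝ → ℝ := fun q => Real.smoothTransition ((b ^ 2 - q) / (b ^ 2 - a ^ 2))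
  have hs : ContDiff ℝ 2 s :=
    Real.smoothTransition.contDiff.comp ((contDiff_const.sub contDiff_id).div_const _)
  have hs1 : ∀ q, q ≤ a ^ 2 → s q = 1 := fun q hq =>
    Real.smoothTransition.one_of_one_le (by rw [le_div_iff₀ hab2]; linarith)
  have hs0 : ∀ q, b ^ 2 ≤ q → s q = 0 := fun q hq =>
    Real.smoothTransition.zero_of_nonpos (div_nonpos_of_nonpos_of_nonneg (by linarith) hab2.le)
  have hsd1 : ∀ q, q < a ^ 2 → deriv s q = 0 := fun q hq => by
    have : s =ᶠ[𝓝 q] fun _ => (1 : ℝ) := by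
      filter_upwards [Iio_mem_nhds hq] with y hy using hs1 y (le_of_lt hy)
    rw [this.deriv_eq]; simp
  have hsd0 : ∀ q, b ^ 2 < q → deriv s q = 0 := fun q hq => by
    have : s =ᶠ[𝓝 q] fun _ => (0 : ℝ) := by
      filter_upwards [Ioi_mem_nhds hq] with y hy using hs0 y (le_of_lt hy)
    rw [this.deriv_eq]; simp
  have hsdc : Continuous (deriv s) := hs.continuous_deriv (by norm_num)
  -- The bump keeps `Q` positive at the origin, where 1/|x|² is singular. It is supported where f
  -- vanishes, so it never enters the estimates.
  let β : ContDiffBump (0 : 𝔼) := ⟨ρ / 4, ρ / 2, by positivity, by linarith⟩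
  let Q : 𝔼 → ℝ := fun x => ‖x‖ ^ 2 + β x
  have hQc : ContDiff ℝ 2 Q := (contDiff_norm_sq ℝ).add β.contDiff
  have hQpos : ∀ x, 0 < Q x := by
    intro x
    by_cases h0 : x = 0
    · have : β x = 1 := β.one_of_mem_closedBall (by simp [h0, β]; positivity)
      simp only [Q, this]; positivity
    · have : 0 < ‖x‖ := norm_pos_iff.2 h0
      have := β.nonneg (x := x)
      simp only [Q]; positivity
  have hQev : ∀ x, ρ ≤ ‖x‖ → Q =ᶠ[𝓝 x] fun y => ‖y‖ ^ 2 := by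
    intro x hx
    filter_upwards [(isOpen_lt continuous_const continuous_norm).mem_nhds
      (show ρ / 2 < ‖x‖ by linarith)] with y hy
    have : β y = 0 := β.zero_of_le_dist (by simpa [β] using le_of_lt hy)
    simp [Q, this]
  have hQeq : ∀ x, ρ ≤ ‖x‖ → Q x = ‖x‖ ^ 2 := fun x hx => (hQev x hx).eq_of_nhds
  have hfz : ∀ x, ‖x‖ < ρ → f =ᶠ[𝓝 x] fun _ => 0 := fun x hx => by
    filter_upwards [(isOpen_lt continuous_norm continuous_const).mem_nhds hx] with y hy using hz y hy
  -- The τ-independent majorant of the squared error term.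
  let K : 𝔼 → ℝ := fun x => (2 * ‖x‖ ^ 2 * deriv s (‖x‖ ^ 2)) ^ 2 * ‖f x‖ ^ 2
  have hKc : Continuous K :=
    (((continuous_const.mul (continuous_norm.pow 2)).mul
      (hsdc.comp (continuous_norm.pow 2))).pow 2).mul (hf.continuous.norm.pow 2)
  have hKi : Integrable K := hKc.integrable_of_hasCompactSupport <|
    HasCompactSupport.of_support_subset_isCompact (isCompact_closedBall (0 : 𝔼) b) fun x hx => by
      contrapose! hx
      have hx' : b < ‖x‖ := by simpa using hx
      have : b ^ 2 < ‖x‖ ^ 2 := by gcongr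
      simp [K, hsd0 _ this]
  let J : 𝔼 → ℝ := (Metric.ball (0 : 𝔼) a).indicator fun x => ‖f x‖ ^ 2
  have hJon : IntegrableOn (fun x => ‖f x‖ ^ 2) (Metric.ball (0 : 𝔼) a) :=
    ((hf.continuous.norm.pow 2).continuousOn.integrableOn_compact
      (isCompact_closedBall (0 : 𝔼) a)).mono_set Metric.ball_subset_closedBall
  have hJi : Integrable J := hJon.integrable_indicator measurableSet_ball
  have main : ∀ τ : ℝ, 0 < τ → 2 * (4 * τ / a ^ 2 * ∫ x, J x) ≤ ∫ x, K x := by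
    intro τ hτ
    -- Normalized to equal 1 on the sphere |x| = a.
    let ψ : 𝔼 → ℝ := fun x => Real.exp (τ * ((Q x)⁻¹ - (a ^ 2)⁻¹))
    let θ : 𝔼 → ℝ := fun x => s (‖x‖ ^ 2) * ψ x
    -- Chosen so that n/2 - h = 2τ/|x|² cancels Eψ = -(2τ/|x|²)ψ for |x| ≥ ρ; only the derivative of
    -- the cutoff survives in `hres`.
    let h : 𝔼 → ℝ := fun x => n / 2 - 2 * τ * (Q x)⁻¹
    let v : 𝔼 → V := fun x => θ x • f x
    have hQi : ContDiff ℝ 2 fun x => (Q x)⁻¹ := hQc.inv fun x => (hQpos x).ne'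
    have hψ : ContDiff ℝ 2 ψ := (contDiff_const.mul (hQi.sub contDiff_const)).exp
    have hθ : ContDiff ℝ 2 θ := (hs.comp (contDiff_norm_sq ℝ)).mul hψ
    have hh : ContDiff ℝ 1 h := (contDiff_const.sub (contDiff_const.mul hQi)).of_le (by norm_num)
    have hv : ContDiff ℝ 2 v := hθ.smul hf
    have hvc : HasCompactSupport v :=
      HasCompactSupport.of_support_subset_isCompact (isCompact_closedBall (0 : 𝔼) b) fun x hx => by
        contrapose! hx
        have hx' : b < ‖x‖ := by simpa using hx
        have : b ^ 2 ≤ ‖x‖ ^ 2 := by gcongr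
        simp [v, θ, hs0 _ this]
    have hQid : ∀ x, ρ ≤ ‖x‖ → HasFDerivAt (fun x => (Q x)⁻¹)
        (-((‖x‖ ^ 2) ^ 2)⁻¹ • (2 : ℝ) • innerSL ℝ x) x := by
      intro x hx
      rw [← hQeq x hx]
      exact (hasDerivAt_inv (hQpos x).ne').comp_hasFDerivAt x
        (hasFDerivAt_norm_sq_of_eventuallyEq (hQev x hx))
    have hEh : ∀ x, ρ ≤ ‖x‖ → fderiv ℝ h x x = 4 * τ / ‖x‖ ^ 2 := by
      intro x hx
      have hx0 : 0 < ‖x‖ := hρ.trans_le hx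
      have : HasFDerivAt h _ x := ((hQid x hx).const_mul (2 * τ)).const_sub (n / 2 : ℝ)
      rw [this.fderiv]
      simp
      field_simp
      ring
    have hθd : ∀ x, ρ ≤ ‖x‖ → HasFDerivAt θ
        ((2 * deriv s (‖x‖ ^ 2) * ψ x - 2 * τ / (‖x‖ ^ 2) ^ 2 * θ x) • innerSL ℝ x) x := by
      intro x hx
      have hx0 : 0 < ‖x‖ := hρ.trans_le hx
      have h1 : HasFDerivAt (fun x : 𝔼 => s (‖x‖ ^ 2))
          (deriv s (‖x‖ ^ 2) • (2 : ℝ) • innerSL ℝ x) x :=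
        HasDerivAt.comp_hasFDerivAt (h₂ := s) (f := fun y : 𝔼 => ‖y‖ ^ 2) x
          ((hs.differentiable two_ne_zero (‖x‖ ^ 2)).hasDerivAt)
          (hasFDerivAt_norm_sq_of_eventuallyEq EventuallyEq.rfl)
      have h2 : HasFDerivAt ψ _ x := (((hQid x hx).sub_const (a ^ 2)⁻¹).const_mul τ).exp
      have h3 : HasFDerivAt θ _ x := h1.mul h2
      refine h3.congr_fderiv ?_
      ext y
      simp [θ, ψ]
      field_simp
      ring
    have hres : ∀ x, fderiv ℝ v x x + angular (angularSymbol A) v x + (n / 2 - h x : ℝ) • v x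
        = (2 * ‖x‖ ^ 2 * deriv s (‖x‖ ^ 2) * ψ x) • f x := by
      intro x
      rw [euler_add_angular]
      rcases lt_or_ge ‖x‖ ρ with hx | hx
      · have hvz : v =ᶠ[𝓝 x] fun _ => 0 := by
          filter_upwards [hfz x hx] with y hy
          simp [v, hy]
        rw [dirac_congr A hvz, hvz.eq_of_nhds, hz x hx]
        simp [dirac]
      · have hx0 : 0 < ‖x‖ := hρ.trans_le hx
        have hd : θ x • dirac A f x = 0 := by
          rcases lt_or_ge ‖x‖ R with hR | hR
          · rw [hD x hR, smul_zero]
          · have : b ^ 2 ≤ ‖x‖ ^ 2 := by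
              have : b ≤ ‖x‖ := by linarith
              gcongr
            simp [θ, hs0 _ this]
        rw [dirac_radial_smul A (hf.differentiable two_ne_zero x) (hθd x hx), hd, add_zero,
          map_smul, adjoint_symbol_apply_self hA, smul_smul, ← smul_assoc, ← add_smul]
        congr 1
        simp only [h, hQeq x hx, smul_eq_mul]
        field_simp
        ring
    have hC := carleman_inequality (angularSymbol A) (inner_angularSymbol hA)
      (angularSymbol_self hA) hv hvc hh
    simp only [hres] at hC
    have hψ1 : ∀ x, a ≤ ‖x‖ → ψ x ≤ 1 := by
      intro x hx
      have : a ^ 2 ≤ ‖x‖ ^ 2 := by gcongr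
      have h2 : (‖x‖ ^ 2)⁻¹ ≤ (a ^ 2)⁻¹ := inv_anti₀ (by positivity) this
      refine Real.exp_le_one_iff.2 (mul_nonpos_of_nonneg_of_nonpos hτ.le ?_)
      rw [hQeq x (by linarith)]; linarith
    have hψ2 : ∀ x, ρ ≤ ‖x‖ → ‖x‖ < a → 1 ≤ ψ x := by
      intro x hx hxa
      have hx0 : 0 < ‖x‖ := hρ.trans_le hx
      have : ‖x‖ ^ 2 ≤ a ^ 2 := by gcongr
      have h2 : (a ^ 2)⁻¹ ≤ (‖x‖ ^ 2)⁻¹ := inv_anti₀ (by positivity) this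
      refine Real.one_le_exp (mul_nonneg hτ.le ?_)
      rw [hQeq x hx]; linarith
    have hup : ∀ x, ‖(2 * ‖x‖ ^ 2 * deriv s (‖x‖ ^ 2) * ψ x) • f x‖ ^ 2 ≤ K x := by
      intro x
      rw [norm_smul, mul_pow, Real.norm_eq_abs, sq_abs]
      refine mul_le_mul_of_nonneg_right ?_ (by positivity)
      rcases lt_or_ge ‖x‖ a with hx | hx
      · have : ‖x‖ ^ 2 < a ^ 2 := by gcongr
        simp [hsd1 _ this]
      · rw [mul_pow _ (ψ x)]
        refine mul_le_of_le_one_right (by positivity) ?_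
        exact pow_le_one₀ (Real.exp_pos _).le (hψ1 x hx)
    have hlow : ∀ x, 4 * τ / a ^ 2 * J x ≤ fderiv ℝ h x x * ‖v x‖ ^ 2 := by
      intro x
      rcases lt_or_ge ‖x‖ ρ with hx | hx
      · have : v x = 0 := by simp [v, hz x hx]
        by_cases hm : x ∈ Metric.ball (0 : 𝔼) a <;> simp [J, this, hm, hz x hx]
      · have hx0 : 0 < ‖x‖ := hρ.trans_le hx
        rw [hEh x hx]
        by_cases hm : x ∈ Metric.ball (0 : 𝔼) a
        · have hxa : ‖x‖ < a := by simpa using hm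
          have h1 : ‖x‖ ^ 2 ≤ a ^ 2 := by gcongr
          have h2 : ‖f x‖ ^ 2 ≤ ‖v x‖ ^ 2 := by
            simp only [v, θ, hs1 _ h1, one_mul]
            rw [norm_smul, Real.norm_eq_abs, abs_of_pos (Real.exp_pos _)]
            have := hψ2 x hx hxa
            gcongr
            exact le_mul_of_one_le_left (norm_nonneg _) this
          simp only [J, Set.indicator_of_mem hm]
          gcongr
        · simp only [J, Set.indicator_of_notMem hm, mul_zero]
          positivity
    have hnc : HasCompactSupport fun x => ‖v x‖ ^ 2 := hvc.mono fun x hx => by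
      contrapose! hx
      simp only [Function.mem_support, not_not] at hx ⊢
      simp [hx]
    have hi1 : Integrable fun x => fderiv ℝ h x x * ‖v x‖ ^ 2 :=
      (((hh.continuous_fderiv one_ne_zero).clm_apply continuous_id).mul
        (hv.continuous.norm.pow 2)).integrable_of_hasCompactSupport hnc.mul_left
    have h1 := integral_mono (hJi.const_mul (4 * τ / a ^ 2)) hi1 hlow
    rw [integral_const_mul] at h1
    have h2 : ∫ x, ‖(2 * ‖x‖ ^ 2 * deriv s (‖x‖ ^ 2) * ψ x) • f x‖ ^ 2 ≤ ∫ x, K x :=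
      integral_mono_of_nonneg (Eventually.of_forall fun x => by positivity) hKi
        (Eventually.of_forall hup)
    linarith
  have hJ0 : ∫ x, J x = 0 := by
    refine le_antisymm ?_ (integral_nonneg fun x => Set.indicator_nonneg (fun y _ => by positivity) x)
    by_contra! hpos
    have hK0 : 0 ≤ ∫ x, K x := integral_nonneg fun x => by positivity
    -- This τ makes the left side equal to ∫K + 1, a contradiction.
    have := main (((∫ x, K x) + 1) * a ^ 2 / (8 * ∫ x, J x)) (by positivity)
    have e : 2 * (4 * (((∫ x, K x) + 1) * a ^ 2 / (8 * ∫ x, J x)) / a ^ 2 * ∫ x, J x)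
        = (∫ x, K x) + 1 := by
      field_simp
      ring
    linarith
  have hae : (fun x => ‖f x‖ ^ 2) =ᵐ[volume.restrict (Metric.ball (0 : 𝔼) a)] fun _ => 0 := by
    rw [integral_indicator measurableSet_ball] at hJ0
    exact (setIntegral_eq_zero_iff_of_nonneg_ae
      (Eventually.of_forall fun x => by positivity) hJon).1 hJ0
  have := Measure.eqOn_open_of_ae_eq hae Metric.isOpen_ball
    (hf.continuous.norm.pow 2).continuousOn continuousOn_const
    (show x ∈ Metric.ball (0 : 𝔼) a by simpa using hx)
  simpa using this

end CliffordSymbol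

/-! ### Mollification and weak unique continuation for C¹ solutions -/

namespace CliffordSymbol

variable {n : ℕ} {V : Type*} [NormedAddCommGroup V] [InnerProductSpace ℝ V]

local notation "𝔼" => EuclideanSpace ℝ (Fin n)

/-- The linear map `L ↦ ∑ A(eᵢ) L(eᵢ)`. -/
def diracCLM (A : EuclideanSpace ℝ (Fin n) →L[ℝ] V →L[ℝ] V) :
    (EuclideanSpace ℝ (Fin n) →L[ℝ] V) →L[ℝ] V :=
  ∑ i, (A (basisVec i)).comp (ContinuousLinearMap.apply ℝ V (basisVec i))

theorem diracCLM_apply (A : 𝔼 →L[ℝ] V →L[ℝ] V) (L : 𝔼 →L[ℝ] V) :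
    diracCLM A L = ∑ i, A (basisVec i) (L (basisVec i)) := by
  simp [diracCLM]

theorem dirac_eq_diracCLM (A : 𝔼 →L[ℝ] V →L[ℝ] V) (f : 𝔼 → V) (x : 𝔼) :
    dirac A f x = diracCLM A (fderiv ℝ f x) := by
  rw [diracCLM_apply, dirac]

variable [CompleteSpace V]

open scoped Convolution

theorem convolution_normed_eq_zero {W : Type*} [NormedAddCommGroup W] [NormedSpace ℝ W]
    (φ : ContDiffBump (0 : 𝔼)) {g : 𝔼 → W} {x : 𝔼} {r : ℝ}
    (hg : ∀ y, ‖y‖ < r → g y = 0) (hx : ‖x‖ < r - φ.rOut) :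
    ∫ t, φ.normed volume t • g (x - t) = 0 := by
  have : ∀ t, φ.normed volume t • g (x - t) = 0 := by
    intro t
    rcases lt_or_ge ‖t‖ φ.rOut with ht | ht
    · rw [hg _ (by linarith [norm_sub_le x t]), smul_zero]
    · have : φ t = 0 := φ.zero_of_le_dist (by simpa using ht)
      simp [ContDiffBump.normed_def, this]
  simp [this]

/-- Constant coefficients let the operator pass under the convolution onto `F`, so mollifying
preserves the equation on a slightly smaller ball. -/
theorem dirac_convolution (A : 𝔼 →L[ℝ] V →L[ℝ] V) (φ : ContDiffBump (0 : 𝔼)) {F : 𝔼 → V}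
    (hF : ContDiff ℝ 1 F) (hFc : HasCompactSupport F) (x : 𝔼) :
    dirac A (φ.normed volume ⋆[ContinuousLinearMap.lsmul ℝ ℝ, volume] F) x
      = ∫ t, φ.normed volume t • dirac A F (x - t) := by
  have hloc : LocallyIntegrable (φ.normed (volume : Measure 𝔼)) volume :=
    (φ.contDiff_normed (n := 0)).continuous.locallyIntegrable
  have hd := hFc.hasFDerivAt_convolution_right (ContinuousLinearMap.lsmul ℝ ℝ) hloc hF x
  rw [dirac_eq_diracCLM, hd.fderiv, convolution_def]
  have hex : ConvolutionExistsAt (φ.normed (volume : Measure 𝔼)) (fderiv ℝ F) x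
      ((ContinuousLinearMap.lsmul ℝ ℝ : ℝ →L[ℝ] V →L[ℝ] V).precompR 𝔼) volume :=
    (hFc.fderiv ℝ).convolutionExists_right _ hloc (hF.continuous_fderiv one_ne_zero) x
  rw [← ContinuousLinearMap.integral_comp_comm _ hex]
  refine integral_congr_ae (Eventually.of_forall fun t => ?_)
  simp only [dirac_eq_diracCLM]
  rw [← map_smul]
  congr 1

/-- The mollifications of a cut-off copy of f fall under the C² case and vanish at x once the
mollifier is narrow; they converge to f(x). -/
theorem eq_zero_on_ball_zero {A : 𝔼 →L[ℝ] V →L[ℝ] V} (hA : ∀ x u, ‖A x u‖ = ‖x‖ * ‖u‖)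
    {f : 𝔼 → V} {ρ R : ℝ} (hf : ContDiffOn ℝ 1 f (Metric.ball 0 R)) (hρ : 0 < ρ)
    (hD : ∀ x, ‖x‖ < R → dirac A f x = 0) (hz : ∀ x, ‖x‖ < ρ → f x = 0)
    {x : 𝔼} (hx : ‖x‖ < R) : f x = 0 := by
  rcases lt_or_ge ‖x‖ ρ with hxρ | hxρ
  · exact hz x hxρ
  have hx0 : 0 < ‖x‖ := hρ.trans_le hxρ
  obtain ⟨R₁, hR1, hR1'⟩ := exists_between hx
  obtain ⟨R₂, hR2, hR2'⟩ := exists_between hR1'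
  let χ : ContDiffBump (0 : 𝔼) := ⟨R₁, R₂, hx0.trans hR1, hR2⟩
  let F : 𝔼 → V := fun y => χ y • f y
  have hFc : HasCompactSupport F := χ.hasCompactSupport.smul_right
  have hF : ContDiff ℝ 1 F := by
    rw [contDiff_iff_contDiffAt]
    intro y
    rcases lt_or_ge ‖y‖ R with hy | hy
    · exact χ.contDiff.contDiffAt.smul (hf.contDiffAt (Metric.isOpen_ball.mem_nhds (by simpa using hy)))
    · have : F =ᶠ[𝓝 y] fun _ => 0 := by
        filter_upwards [(isOpen_lt continuous_const continuous_norm).mem_nhds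
          (hR2'.trans_le hy)] with z hz
        have : χ z = 0 := χ.zero_of_le_dist (by simpa [χ] using le_of_lt hz)
        simp [F, this]
      exact contDiffAt_const.congr_of_eventuallyEq this
  have hFf : ∀ y, ‖y‖ < R₁ → F =ᶠ[𝓝 y] f := by
    intro y hy
    filter_upwards [(isOpen_lt continuous_norm continuous_const).mem_nhds hy] with z hz
    have : χ z = 1 := χ.one_of_mem_closedBall (by simpa [χ] using le_of_lt hz)
    simp [F, this]
  have hFD : ∀ y, ‖y‖ < R₁ → dirac A F y = 0 := fun y hy => by
    rw [dirac_congr A (hFf y hy), hD y (hy.trans hR1')]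
  have hFz : ∀ y, ‖y‖ < ρ → F y = 0 := fun y hy => by simp [F, hz y hy]
  rw [← (hFf x hR1).eq_of_nhds]
  let φ : ℕ → ContDiffBump (0 : 𝔼) := fun k =>
    ⟨1 / ((k : ℝ) + 1) / 2, 1 / ((k : ℝ) + 1), by positivity, half_lt_self (by positivity)⟩
  have hφ : Tendsto (fun k => (φ k).rOut) atTop (𝓝 0) := tendsto_one_div_add_atTop_nhds_zero_nat
  have hconv := ContDiffBump.convolution_tendsto_right_of_continuous (μ := volume) hφ
    hF.continuous x
  refine tendsto_nhds_unique hconv (tendsto_const_nhds.congr' ?_)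
  -- The first bound keeps the mollification zero on the ball of radius ρ/2. The second leaves room
  -- for ‖x‖ < a < b < R₁ - rOut below.
  have hε : 0 < min (ρ / 2) ((R₁ - ‖x‖) / 4) := lt_min (by positivity) (by linarith)
  filter_upwards [hφ.eventually_lt_const hε] with k hk
  have hk1 : (φ k).rOut < ρ / 2 := hk.trans_le (min_le_left _ _)
  have hk2 : (φ k).rOut < (R₁ - ‖x‖) / 4 := hk.trans_le (min_le_right _ _)
  have hsm : ContDiff ℝ 2
      ((φ k).normed volume ⋆[ContinuousLinearMap.lsmul ℝ ℝ, volume] F) :=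
    (φ k).hasCompactSupport_normed.contDiff_convolution_left (n := 2) _ (φ k).contDiff_normed
      hF.continuous.locallyIntegrable
  refine (eq_zero_on_ball_of_cutoff hA hsm (ρ := ρ / 2) (a := ‖x‖ + (R₁ - ‖x‖) / 4)
    (b := ‖x‖ + (R₁ - ‖x‖) / 2) (R := R₁ - (φ k).rOut) (by positivity) (by linarith) (by linarith)
    (by linarith) ?_ ?_ (by linarith)).symm
  · intro y hy
    rw [dirac_convolution A (φ k) hF hFc]
    exact convolution_normed_eq_zero (φ k) hFD hy
  · intro y hy
    rw [convolution_def]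
    exact convolution_normed_eq_zero (φ k) hFz (by linarith)

theorem eq_zero_on_ball {A : 𝔼 →L[ℝ] V →L[ℝ] V} (hA : ∀ x u, ‖A x u‖ = ‖x‖ * ‖u‖)
    {f : 𝔼 → V} {c : 𝔼} {R : ℝ} (hf : ContDiffOn ℝ 1 f (Metric.ball c R))
    (hD : ∀ x ∈ Metric.ball c R, dirac A f x = 0) (hz : f =ᶠ[𝓝 c] fun _ => 0) :
    ∀ x ∈ Metric.ball c R, f x = 0 := by
  intro x hx
  obtain ⟨ρ, hρ, hρz⟩ := Metric.eventually_nhds_iff_ball.1 hz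
  have hmem : ∀ {y : 𝔼} {r : ℝ}, ‖y‖ < r → y + c ∈ Metric.ball c r := fun h => by simpa using h
  have := eq_zero_on_ball_zero hA (f := fun y => f (y + c)) (ρ := ρ) (R := R) (x := x - c)
    (hf.comp (contDiff_id.add contDiff_const).contDiffOn fun y hy => hmem (by simpa using hy)) hρ
    (fun y hy => by
      rw [dirac, fderiv_comp_add_right]
      exact hD _ (hmem hy))
    (fun y hy => hρz _ (hmem hy)) (by simpa [dist_eq_norm] using hx)
  simpa using this

/-- Weak unique continuation for Dirac type operators. -/
theorem eq_zero_of_eventuallyEq_zero {A : 𝔼 →L[ℝ] V →L[ℝ] V} (hA : ∀ x u, ‖A x u‖ = ‖x‖ * ‖u‖)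
    {f : 𝔼 → V} {U : Set 𝔼} (hU : IsOpen U) (hUc : IsPreconnected U) (hf : ContDiffOn ℝ 1 f U)
    (hD : ∀ x ∈ U, dirac A f x = 0) {c : 𝔼} (hc : c ∈ U) (hz : f =ᶠ[𝓝 c] fun _ => 0) :
    ∀ x ∈ U, f x = 0 := by
  let Z : Set 𝔼 := {x | f =ᶠ[𝓝 x] fun _ => 0}
  have hsub : U ⊆ Z := by
    refine hUc.subset_of_closure_inter_subset isOpen_setOfPred_eventually_nhds ⟨c, hc, hz⟩ ?_
    rintro x ⟨hxc, hxU⟩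
    obtain ⟨r, hr, hball⟩ := Metric.isOpen_iff.1 hU x hxU
    -- Half the radius makes the ball about `z` contain `x` yet stay inside `U`.
    obtain ⟨z, hzZ, hzx⟩ := Metric.mem_closure_iff.1 hxc (r / 2) (by positivity)
    have hsub : Metric.ball z (r / 2) ⊆ U := fun y hy => hball <| by
      rw [Metric.mem_ball] at hy ⊢
      linarith [dist_triangle y z x, dist_comm x z]
    have h0 := eq_zero_on_ball hA (hf.mono hsub) (fun y hy => hD y (hsub hy)) hzZ
    exact eventually_of_mem (Metric.isOpen_ball.mem_nhds hzx) h0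
  exact fun x hx => (hsub hx).eq_of_nhds

end CliffordSymbol

/-! ### Extending by zero across a frontier -/

section Gluing

theorem continuousAt_indicator_of_frontier {X Y : Type*} [TopologicalSpace X]
    [NormedAddCommGroup Y] {f : X → Y} {S : Set X} {x : X} (hf : ContinuousAt f x)
    (h : x ∈ frontier S → f x = 0) : ContinuousAt (S.indicator f) x := by
  by_cases hfr : x ∈ frontier S
  · have h0 := h hfr
    have e2 : S.indicator f x = 0 := by
      by_cases hx : x ∈ S <;> simp [hx, h0]
    rw [ContinuousAt, e2]
    rw [ContinuousAt, h0] at hf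
    exact squeeze_zero_norm (fun y => norm_indicator_le_norm_self f y) (by simpa using hf.norm)
  · rw [frontier, Set.mem_sdiff, not_and_or, not_not] at hfr
    rcases hfr with hx | hx
    · have hx' : Sᶜ ∈ 𝓝 x := by
        rw [← mem_interior_iff_mem_nhds, interior_compl]; exact hx
      refine (continuousAt_const (y := (0 : Y))).congr ?_
      filter_upwards [hx'] with y hy using (Set.indicator_of_notMem hy _).symm
    · refine hf.congr ?_
      filter_upwards [mem_interior_iff_mem_nhds.1 hx] with y hy
        using (Set.indicator_of_mem hy _).symm

variable {X Y : Type*} [NormedAddCommGroup X] [NormedSpace ℝ X] [NormedAddCommGroup Y]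
  [NormedSpace ℝ Y]

/-- At a frontier point f is o(|y - x|), and the truncation is no larger in norm. Elsewhere the
truncation is locally f or 0. -/
theorem hasFDerivAt_indicator {f : X → Y} {S : Set X} {x : X} (hf : DifferentiableAt ℝ f x)
    (h : x ∈ frontier S → f x = 0 ∧ fderiv ℝ f x = 0) :
    HasFDerivAt (S.indicator f) (S.indicator (fderiv ℝ f) x) x := by
  by_cases hfr : x ∈ frontier S
  · obtain ⟨h0, h1⟩ := h hfr
    have e1 : S.indicator (fderiv ℝ f) x = 0 := by
      by_cases hx : x ∈ S <;> simp [hx, h1]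
    have e2 : S.indicator f x = 0 := by
      by_cases hx : x ∈ S <;> simp [hx, h0]
    have hd := hf.hasFDerivAt
    rw [h1] at hd
    rw [e1]
    rw [hasFDerivAt_iff_isLittleO] at hd ⊢
    refine (Asymptotics.isBigO_of_le _ fun y => ?_).trans_isLittleO hd
    simp only [e2, h0, sub_zero, _root_.zero_apply]
    exact norm_indicator_le_norm_self _ _
  · rw [frontier, Set.mem_sdiff, not_and_or, not_not] at hfr
    rcases hfr with hx | hx
    · have hx' : Sᶜ ∈ 𝓝 x := by
        rw [← mem_interior_iff_mem_nhds, interior_compl]; exact hx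
      have hxS : x ∉ S := mem_of_mem_nhds hx'
      rw [Set.indicator_of_notMem hxS]
      refine (hasFDerivAt_const (0 : Y) x).congr_of_eventuallyEq ?_
      filter_upwards [hx'] with y hy using Set.indicator_of_notMem hy _
    · have hx' : S ∈ 𝓝 x := mem_interior_iff_mem_nhds.1 hx
      rw [Set.indicator_of_mem (mem_of_mem_nhds hx')]
      refine hf.hasFDerivAt.congr_of_eventuallyEq ?_
      filter_upwards [hx'] with y hy using Set.indicator_of_mem hy _

theorem contDiffOn_one_indicator {f : X → Y} {S U : Set X} (hU : IsOpen U)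
    (hf : ContDiffOn ℝ 1 f U) (h : ∀ x ∈ U, x ∈ frontier S → f x = 0 ∧ fderiv ℝ f x = 0) :
    ContDiffOn ℝ 1 (S.indicator f) U := by
  intro x hx
  refine ContDiffAt.contDiffWithinAt (contDiffAt_one_iff.2
    ⟨S.indicator (fderiv ℝ f), U, hU.mem_nhds hx, fun y hy => ?_, fun y hy => ?_⟩)
  · exact (continuousAt_indicator_of_frontier
      ((hf.continuousOn_fderiv_of_isOpen hU le_rfl).continuousAt (hU.mem_nhds hy))
      fun hfr => (h y hy hfr).2).continuousWithinAt
  · exact hasFDerivAt_indicator ((hf.differentiableOn one_ne_zero).differentiableAt (hU.mem_nhds hy))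
      (h y hy)

end Gluing

/-! ### Unique continuation from an immersed hypersurface -/

namespace CliffordSymbol

variable {m : ℕ} {V : Type*} [NormedAddCommGroup V] [InnerProductSpace ℝ V]

theorem exists_normal (L : EuclideanSpace ℝ (Fin m) →L[ℝ] EuclideanSpace ℝ (Fin (m + 1))) :
    ∃ ν : EuclideanSpace ℝ (Fin (m + 1)), ν ≠ 0 ∧ ∀ y, inner ℝ ν (L y) = 0 := by
  let W := LinearMap.range (L : EuclideanSpace ℝ (Fin m) →ₗ[ℝ] EuclideanSpace ℝ (Fin (m + 1)))
  have hW : Wᗮ ≠ ⊥ := by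
    rw [Ne, Submodule.orthogonal_eq_bot_iff]
    intro h
    have h1 := LinearMap.finrank_range_le
      (L : EuclideanSpace ℝ (Fin m) →ₗ[ℝ] EuclideanSpace ℝ (Fin (m + 1)))
    change Module.finrank ℝ W ≤ _ at h1
    rw [h, finrank_top] at h1
    simp at h1
  obtain ⟨ν, hν, hν0⟩ := Submodule.exists_mem_ne_zero_of_ne_bot hW
  refine ⟨ν, hν0, fun y => ?_⟩
  rw [real_inner_comm]
  exact (Submodule.mem_orthogonal W ν).1 hν (L y) ⟨y, rfl⟩

theorem injective_coprod {L : EuclideanSpace ℝ (Fin m) →L[ℝ] EuclideanSpace ℝ (Fin (m + 1))}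
    (hL : Function.Injective L) {ν : EuclideanSpace ℝ (Fin (m + 1))} (hν0 : ν ≠ 0)
    (hν : ∀ y, inner ℝ ν (L y) = 0) :
    Function.Injective (L.coprod (ContinuousLinearMap.toSpanSingleton ℝ ν)) := by
  rw [injective_iff_map_eq_zero]
  rintro ⟨y, s⟩ h
  have h' : L y + s • ν = 0 := by simpa using h
  have hs : s = 0 := by
    have := congrArg (fun z => inner ℝ ν z) h'
    simpa [inner_add_right, inner_smul_right, hν, hν0] using this
  subst hs
  have hy : L y = 0 := by simpa using h'
  rw [(injective_iff_map_eq_zero L).1 hL y hy]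
  rfl

/-- The derivative of the flow-out `(y, s) ↦ g y + s ν` of a hypersurface. -/
def normalEquiv {L : EuclideanSpace ℝ (Fin m) →L[ℝ] EuclideanSpace ℝ (Fin (m + 1))}
    (hL : Function.Injective L) {ν : EuclideanSpace ℝ (Fin (m + 1))} (hν0 : ν ≠ 0)
    (hν : ∀ y, inner ℝ ν (L y) = 0) :
    (EuclideanSpace ℝ (Fin m) × ℝ) ≃L[ℝ] EuclideanSpace ℝ (Fin (m + 1)) :=
  (LinearEquiv.ofInjectiveOfFinrankEq
    ((L.coprod (ContinuousLinearMap.toSpanSingleton ℝ ν) :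
      (EuclideanSpace ℝ (Fin m) × ℝ) →L[ℝ] EuclideanSpace ℝ (Fin (m + 1))) :
      (EuclideanSpace ℝ (Fin m) × ℝ) →ₗ[ℝ] EuclideanSpace ℝ (Fin (m + 1)))
    (injective_coprod hL hν0 hν) (by simp)).toContinuousLinearEquiv

theorem coe_normalEquiv {L : EuclideanSpace ℝ (Fin m) →L[ℝ] EuclideanSpace ℝ (Fin (m + 1))}
    (hL : Function.Injective L) {ν : EuclideanSpace ℝ (Fin (m + 1))} (hν0 : ν ≠ 0)
    (hν : ∀ y, inner ℝ ν (L y) = 0) :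
    (normalEquiv hL hν0 hν :
      (EuclideanSpace ℝ (Fin m) × ℝ) →L[ℝ] EuclideanSpace ℝ (Fin (m + 1)))
      = L.coprod (ContinuousLinearMap.toSpanSingleton ℝ ν) := by
  ext x <;> rfl

/-- No hypersurface is characteristic: if B kills the tangent directions then |ν|²B(z) = ⟨ν, z⟩B(ν),
so the equation says A(ν)B(ν) = 0, and A(ν) is injective. -/
theorem eq_zero_of_comp_eq_zero_of_diracCLM {A : EuclideanSpace ℝ (Fin (m + 1)) →L[ℝ] V →L[ℝ] V}
    (hA : ∀ x u, ‖A x u‖ = ‖x‖ * ‖u‖) (B : EuclideanSpace ℝ (Fin (m + 1)) →L[ℝ] V)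
    {L : EuclideanSpace ℝ (Fin m) →L[ℝ] EuclideanSpace ℝ (Fin (m + 1))}
    (hL : Function.Injective L) (hBL : ∀ y, B (L y) = 0) (hB : diracCLM A B = 0) : B = 0 := by
  obtain ⟨ν, hν0, hν⟩ := exists_normal L
  have hνpos : 0 < ‖ν‖ := norm_pos_iff.2 hν0
  have hsurj : ∀ z, ∃ y, ∃ s : ℝ, z = L y + s • ν := fun z => by
    obtain ⟨⟨y, s⟩, rfl⟩ := (normalEquiv hL hν0 hν).surjective z
    exact ⟨y, s, by rw [← ContinuousLinearEquiv.coe_coe, coe_normalEquiv]; simp⟩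
  have hform : ∀ z, ‖ν‖ ^ 2 • B z = (inner ℝ ν z : ℝ) • B ν := fun z => by
    obtain ⟨y, s, rfl⟩ := hsurj z
    simp [hBL, inner_add_right, inner_smul_right, hν, smul_smul, mul_comm]
  have hzero : A ν (B ν) = 0 := by
    have h1 : ‖ν‖ ^ 2 • diracCLM A B = A ν (B ν) := by
      rw [diracCLM_apply, Finset.smul_sum, clm_apply_eq_sum A ν, _root_.sum_apply]
      refine Finset.sum_congr rfl fun i _ => ?_
      rw [← map_smul, hform, map_smul]
      simp [basisVec, EuclideanSpace.inner_single_right]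
    rw [← h1, hB, smul_zero]
  have hBν : B ν = 0 := by
    have := hA ν (B ν)
    rw [hzero, norm_zero] at this
    have := mul_eq_zero.1 this.symm
    simpa [hν0] using this
  ext z
  have := hform z
  rw [hBν, smul_zero] at this
  simpa [hνpos.ne'] using this

variable [CompleteSpace V]

/-- Solutions of a Dirac type equation which vanish on an immersed hypersurface vanish. -/
theorem eq_zero_of_eq_zero_on_immersion {A : EuclideanSpace ℝ (Fin (m + 1)) →L[ℝ] V →L[ℝ] V}
    (hA : ∀ x u, ‖A x u‖ = ‖x‖ * ‖u‖) {f : EuclideanSpace ℝ (Fin (m + 1)) → V}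
    {U : Set (EuclideanSpace ℝ (Fin (m + 1)))} (hU : IsOpen U) (hUc : IsPreconnected U)
    (hf : ContDiffOn ℝ 1 f U) (hD : ∀ x ∈ U, dirac A f x = 0)
    {g : EuclideanSpace ℝ (Fin m) → EuclideanSpace ℝ (Fin (m + 1))} {y₀ : EuclideanSpace ℝ (Fin m)}
    (hg : ContDiffAt ℝ 1 g y₀) (hinj : Function.Injective (fderiv ℝ g y₀))
    (hgU : ∀ᶠ y in 𝓝 y₀, g y ∈ U ∧ f (g y) = 0) : ∀ x ∈ U, f x = 0 := by
  have hfd : ∀ x ∈ U, DifferentiableAt ℝ f x := fun x hx =>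
    (hf.differentiableOn one_ne_zero).differentiableAt (hU.mem_nhds hx)
  -- the gradient vanishes along the hypersurface
  have hN : ∀ᶠ y in 𝓝 y₀, g y ∈ U ∧ f (g y) = 0 ∧ fderiv ℝ f (g y) = 0 := by
    have hdiff : ∀ᶠ y in 𝓝 y₀, DifferentiableAt ℝ g y :=
      (hg.eventually (by simp)).mono fun y hy => hy.differentiableAt one_ne_zero
    have hinj' : ∀ᶠ y in 𝓝 y₀, Function.Injective (fderiv ℝ g y) :=
      (hg.continuousAt_fderiv one_ne_zero).eventually
        (ContinuousLinearMap.isOpen_injective.mem_nhds hinj)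
    filter_upwards [hgU.eventually_nhds, hdiff, hinj'] with y hy hd hi
    have hyU := hy.self_of_nhds
    refine ⟨hyU.1, hyU.2, eq_zero_of_comp_eq_zero_of_diracCLM hA _ hi (fun z => ?_) ?_⟩
    · have h1 : HasFDerivAt (f ∘ g) _ y := (hfd _ hyU.1).hasFDerivAt.comp y hd.hasFDerivAt
      have h2 : (f ∘ g) =ᶠ[𝓝 y] fun _ => 0 := hy.mono fun z hz => hz.2
      have h3 := h2.fderiv_eq (𝕜 := ℝ)
      rw [h1.fderiv] at h3
      simpa using congrArg (fun T : EuclideanSpace ℝ (Fin m) →L[ℝ] V => T z) h3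
    · rw [← dirac_eq_diracCLM]; exact hD _ hyU.1
  obtain ⟨ν, hν0, hν⟩ := exists_normal (fderiv ℝ g y₀)
  -- By the inverse function theorem Φ gives local coordinates in which the hypersurface is `s = 0`;
  -- the sign of `s` tells its two sides apart.
  let Φ : EuclideanSpace ℝ (Fin m) × ℝ → EuclideanSpace ℝ (Fin (m + 1)) := fun q => g q.1 + q.2 • ν
  have hΦ : HasStrictFDerivAt Φ (normalEquiv hinj hν0 hν :
      (EuclideanSpace ℝ (Fin m) × ℝ) →L[ℝ] EuclideanSpace ℝ (Fin (m + 1))) (y₀, 0) := by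
    rw [coe_normalEquiv]
    have h1 : HasStrictFDerivAt (fun q : EuclideanSpace ℝ (Fin m) × ℝ => g q.1) _ (y₀, (0 : ℝ)) :=
      HasStrictFDerivAt.comp (y₀, (0 : ℝ)) (hg.hasStrictFDerivAt one_ne_zero) hasStrictFDerivAt_fst
    have h2 : HasStrictFDerivAt (fun q : EuclideanSpace ℝ (Fin m) × ℝ => q.2 • ν) _ (y₀, (0 : ℝ)) :=
      HasStrictFDerivAt.comp (g := fun s : ℝ => s • ν) (y₀, (0 : ℝ))
        (ContinuousLinearMap.toSpanSingleton ℝ ν).hasStrictFDerivAt hasStrictFDerivAt_snd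
    refine (h1.add h2).congr_fderiv ?_
    ext x <;> simp
  let e := hΦ.toOpenPartialHomeomorph Φ
  have hesrc : (y₀, (0 : ℝ)) ∈ e.source := hΦ.mem_toOpenPartialHomeomorph_source
  have hetgt : Φ (y₀, 0) ∈ e.target := hΦ.image_mem_toOpenPartialHomeomorph_target
  have he : ∀ q, e q = Φ q := fun q => rfl
  have hesymm : e.symm (Φ (y₀, 0)) = (y₀, 0) := e.left_inv hesrc
  have hΦ0 : ∀ y, Φ (y, 0) = g y := fun y => by simp [Φ]
  have hT : ∀ᶠ x in 𝓝 (Φ (y₀, 0)), x ∈ e.target ∧ x ∈ U ∧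
      (g (e.symm x).1 ∈ U ∧ f (g (e.symm x).1) = 0 ∧ fderiv ℝ f (g (e.symm x).1) = 0) := by
    refine (e.open_target.eventually_mem hetgt).and ((hU.eventually_mem ?_).and ?_)
    · rw [hΦ0]; exact hN.self_of_nhds.1
    · have hc : Tendsto (fun x => (e.symm x).1) (𝓝 (Φ (y₀, 0))) (𝓝 y₀) := by
        have := (continuous_fst.tendsto (e.symm (Φ (y₀, 0)))).comp (e.continuousAt_symm hetgt)
        rwa [hesymm] at this
      exact hc.eventually hN
  obtain ⟨r, hr, hball⟩ := Metric.eventually_nhds_iff_ball.1 hT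
  let B := Metric.ball (Φ (y₀, 0)) r
  let S : Set (EuclideanSpace ℝ (Fin (m + 1))) := {x | 0 < (e.symm x).2}
  have hσ : ∀ x ∈ B, ContinuousAt (fun x => (e.symm x).2) x := fun x hx =>
    continuous_snd.continuousAt.comp (e.continuousAt_symm (hball x hx).1)
  have hfr : ∀ x ∈ B, x ∈ frontier S → f x = 0 ∧ fderiv ℝ f x = 0 := by
    intro x hx hxS
    have h0 : (e.symm x).2 = 0 := by
      rcases lt_trichotomy (e.symm x).2 0 with hlt | heq | hgt
      · exfalso
        have : Sᶜ ∈ 𝓝 x := by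
          filter_upwards [(hσ x hx).eventually_lt_const hlt] with y hy
          exact not_lt.2 hy.le
        rw [← mem_interior_iff_mem_nhds, interior_compl] at this
        exact this hxS.1
      · exact heq
      · exfalso
        have : S ∈ 𝓝 x := (hσ x hx).eventually_const_lt hgt
        exact hxS.2 (mem_interior_iff_mem_nhds.2 this)
    have hxg : x = g (e.symm x).1 := by
      have h1 := e.right_inv (hball x hx).1
      rw [he, show e.symm x = ((e.symm x).1, 0) from Prod.ext rfl h0, hΦ0] at h1
      exact h1.symm
    have := (hball x hx).2.2.2
    rwa [← hxg] at this
  have hBU : B ⊆ U := fun x hx => (hball x hx).2.1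
  have hline : Tendsto (fun s : ℝ => Φ (y₀, s)) (𝓝 0) (𝓝 (Φ (y₀, 0))) := by
    have : Continuous fun s : ℝ => Φ (y₀, s) := by
      simp only [Φ]; fun_prop
    exact this.tendsto 0
  have hsrc : ∀ᶠ s : ℝ in 𝓝 0, (y₀, s) ∈ e.source ∧ Φ (y₀, s) ∈ B :=
    ((by fun_prop : Continuous fun s : ℝ => (y₀, s)).tendsto 0).eventually
      (e.open_source.eventually_mem hesrc) |>.and (hline.eventually (Metric.ball_mem_nhds _ hr))
  obtain ⟨δ, hδ, hδs⟩ := Metric.eventually_nhds_iff_ball.1 hsrc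
  have hpos := hδs (δ / 2) (by simp [abs_of_pos hδ, hδ])
  have hneg := hδs (-(δ / 2)) (by simp [abs_of_pos hδ, hδ])
  -- The truncation solves the equation on the ball and is zero near the point with s = -δ/2, so it
  -- vanishes throughout. Near s = δ/2 it coincides with f, which starts the continuation in `U`.
  have hzeroB : ∀ x ∈ B, S.indicator f x = 0 := by
    refine eq_zero_of_eventuallyEq_zero hA Metric.isOpen_ball
      (convex_ball _ _).isPreconnected
      (contDiffOn_one_indicator Metric.isOpen_ball (hf.mono hBU) hfr) ?_ hneg.2 ?_
    · intro x hx
      rw [dirac_eq_diracCLM, (hasFDerivAt_indicator (hfd x (hBU hx)) (hfr x hx)).fderiv]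
      by_cases hxS : x ∈ S
      · rw [Set.indicator_of_mem hxS, ← dirac_eq_diracCLM]; exact hD x (hBU hx)
      · rw [Set.indicator_of_notMem hxS, map_zero]
    · have hlt : (e.symm (Φ (y₀, -(δ / 2)))).2 < 0 := by
        rw [← he, e.left_inv hneg.1]; simpa using hδ
      filter_upwards [(hσ _ hneg.2).eventually_lt_const hlt] with y hy
      exact Set.indicator_of_notMem (s := S) (not_lt.2 hy.le) f
  refine eq_zero_of_eventuallyEq_zero hA hU hUc hf hD (hBU hpos.2) ?_
  have hgt : 0 < (e.symm (Φ (y₀, δ / 2))).2 := by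
    rw [← he, e.left_inv hpos.1]; simpa using hδ
  filter_upwards [(hσ _ hpos.2).eventually_const_lt hgt, Metric.isOpen_ball.mem_nhds hpos.2]
    with y hy hyB
  rw [← Set.indicator_of_mem (show y ∈ S from hy) f]
  exact hzeroB y hyB

end CliffordSymbol

/-! ### Multiplicativity of the octonion norm -/

namespace Octonion

/-- Degen's eight-square identity, checked as a polynomial identity in the sixteen coordinates. -/
theorem norm_mul (x y : Octonion) : ‖Octonion.mul x y‖ = ‖x‖ * ‖y‖ := by
  have h : ‖Octonion.mul x y‖ ^ 2 = (‖x‖ * ‖y‖) ^ 2 := by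
    rw [mul_pow, EuclideanSpace.norm_sq_eq, EuclideanSpace.norm_sq_eq, EuclideanSpace.norm_sq_eq]
    simp only [Octonion.mul, Real.norm_eq_abs, sq_abs]
    simp only [Fin.sum_univ_eight]
    simp [Octonion.structConst, Octonion.eps, Octonion.triples]
    ring
  exact (sq_eq_sq₀ (norm_nonneg _) (by positivity)).1 h

/-- Octonion multiplication as a continuous bilinear map. -/
def mulCLM : Octonion →L[ℝ] Octonion →L[ℝ] Octonion :=
  LinearMap.mkContinuous₂
    (LinearMap.mk₂ ℝ Octonion.mul
      (fun x y z => by ext k; simp [Octonion.mul, add_mul, Finset.sum_add_distrib])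
      (fun c x y => by ext k; simp [Octonion.mul, mul_assoc, Finset.mul_sum])
      (fun x y z => by ext k; simp [Octonion.mul, mul_add, add_mul, Finset.sum_add_distrib])
      (fun c x y => by ext k; simp [Octonion.mul, mul_assoc, mul_left_comm, Finset.mul_sum]))
    1 (fun x y => by simp [norm_mul])

theorem mulCLM_apply (x y : Octonion) : mulCLM x y = Octonion.mul x y := rfl

end Octonion

/-! ### Geometry of the slices -/

section Slices

variable (p : Fin 7) (w : Octonion)

/-- `slicePoint` as a continuous linear map. -/
def slicePointCLM : SliceSpace p →L[ℝ] Octonion :=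
  LinearMap.toContinuousLinearMap
    { toFun := slicePoint p w
      map_add' := fun x y => by
        simp only [slicePoint, PiLp.add_apply, add_smul, Finset.sum_add_distrib]; abel
      map_smul' := fun c x => by
        simp [slicePoint, smul_smul, Finset.smul_sum] }

theorem slicePointCLM_apply (x : SliceSpace p) : slicePointCLM p w x = slicePoint p w x := rfl

/-- The symbol `ξ ↦ (u ↦ ξ u)` of `D_w`. -/
def sliceSymbol : SliceSpace p →L[ℝ] Octonion →L[ℝ] Octonion :=
  Octonion.mulCLM.comp (slicePointCLM p w)

variable {w}

/-- The vectors e₀, …, e_p, w are orthonormal. -/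
theorem norm_slicePoint (hw : w ∈ imagSphere p) (x : SliceSpace p) : ‖slicePoint p w x‖ = ‖x‖ := by
  have hwn : ‖w‖ ^ 2 = 1 := by
    rw [EuclideanSpace.norm_sq_eq]; simpa using hw.2
  have ho : Orthonormal ℝ fun i : Fin ((p : ℕ) + 1) => Octonion.e (Fin.castLE (by omega) i) := by
    have := (EuclideanSpace.basisFun (Fin 8) ℝ).orthonormal.comp
      (Fin.castLE (by omega : (p : ℕ) + 1 ≤ 8)) (Fin.castLE_injective _)
    simpa [Function.comp_def, Octonion.e] using this
  have h1 : inner ℝ (∑ i : Fin ((p : ℕ) + 1),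
      x i.castSucc • Octonion.e (Fin.castLE (by omega) i)) (x (Fin.last _) • w) = (0 : ℝ) := by
    rw [sum_inner]
    refine Finset.sum_eq_zero fun i _ => ?_
    have : w (Fin.castLE (by omega) i) = 0 := hw.1 _ (by simpa using Nat.lt_succ_iff.1 i.2)
    simp [Octonion.e, inner_smul_left, inner_smul_right, EuclideanSpace.inner_single_left, this]
  have h2 : ‖∑ i : Fin ((p : ℕ) + 1), x i.castSucc • Octonion.e (Fin.castLE (by omega) i)‖ ^ 2
      = ∑ i : Fin ((p : ℕ) + 1), x i.castSucc ^ 2 := by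
    rw [← real_inner_self_eq_norm_sq, ho.inner_sum]
    simp [sq]
  have h3 : ‖x‖ ^ 2 = ∑ i : Fin ((p : ℕ) + 1), x i.castSucc ^ 2 + x (Fin.last _) ^ 2 := by
    rw [EuclideanSpace.norm_sq_eq, Fin.sum_univ_castSucc]
    simp only [Real.norm_eq_abs, sq_abs]
  have h : ‖slicePoint p w x‖ ^ 2 = ‖x‖ ^ 2 := by
    rw [slicePoint, norm_add_sq_real, h1, h2, h3, norm_smul, mul_pow, hwn]
    simp
  exact (sq_eq_sq₀ (norm_nonneg _) (norm_nonneg _)).1 h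

theorem norm_sliceSymbol (hw : w ∈ imagSphere p) (x : SliceSpace p) (u : Octonion) :
    ‖sliceSymbol p w x u‖ = ‖x‖ * ‖u‖ := by
  rw [← norm_slicePoint p hw x]
  exact Octonion.norm_mul _ _

variable (w) in
theorem sliceDirac_eq_dirac (F : SliceSpace p → Octonion) (x : SliceSpace p) :
    sliceDirac p w F x = CliffordSymbol.dirac (sliceSymbol p w) F x := by
  have h1 : ∀ i : Fin ((p : ℕ) + 1),
      slicePoint p w (EuclideanSpace.single i.castSucc 1) = Octonion.e (Fin.castLE (by omega) i) := by
    intro i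
    rw [slicePoint, Finset.sum_eq_single i]
    · simp [(Fin.castSucc_ne_last i).symm]
    · intro j _ hj
      simp [hj]
    · simp
  have h2 : slicePoint p w (EuclideanSpace.single (Fin.last _) 1) = w := by
    rw [slicePoint, Finset.sum_eq_zero]
    · simp
    · intro j _
      simp [Fin.castSucc_ne_last j]
  rw [CliffordSymbol.dirac, Fin.sum_univ_castSucc]
  simp only [sliceDirac, partialD, sliceSymbol, ContinuousLinearMap.comp_apply,
    slicePointCLM_apply, Octonion.mulCLM_apply, CliffordSymbol.basisVec, h1, h2]

theorem exists_slicePoint_eq {η : Octonion} (hη : η ∈ imagSphere p) (x : Octonion) :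
    ∃ w ∈ imagSphere p, ∃ y : SliceSpace p, slicePoint p w y = x := by
  let v : Octonion := WithLp.toLp 2 fun i => if (i : ℕ) ≤ p then 0 else x i
  have hv : ∀ i : Fin 8, (i : ℕ) ≤ (p : ℕ) → v i = 0 := fun i hi => by simp [v, hi]
  have hcoord : ∀ (w : Octonion) (r : ℝ), r • w = v →
      slicePoint p w (WithLp.toLp 2 (Fin.snoc (α := fun _ => ℝ)
        (fun i : Fin ((p : ℕ) + 1) => x (Fin.castLE (by omega) i)) r)) = x := by
    intro w r hr
    simp only [slicePoint, Fin.snoc_castSucc, Fin.snoc_last, hr]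
    ext k
    simp only [PiLp.add_apply, WithLp.ofLp_sum, Finset.sum_apply, PiLp.smul_apply, Octonion.e,
      smul_eq_mul]
    by_cases hk : (k : ℕ) ≤ p
    · rw [hv k hk, add_zero, Finset.sum_eq_single ⟨k, by omega⟩]
      · simp
      · intro j _ hj
        have : k ≠ Fin.castLE (by omega) j := fun h => hj (by ext; simp [h])
        simp [this]
      · simp
    · rw [Finset.sum_eq_zero]
      · simp [v, hk]
      · intro j _
        have : k ≠ Fin.castLE (by omega) j := fun h => hk (by rw [h]; simp; omega)
        simp [this]
  -- A point of ℝᵖ⁺¹ lies in every slice, so the given η serves; otherwise the direction is forced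
  -- up to sign.
  by_cases hv0 : v = 0
  · exact ⟨η, hη, _, hcoord η 0 (by simp [hv0])⟩
  · have hn : 0 < ‖v‖ := norm_pos_iff.2 hv0
    refine ⟨‖v‖⁻¹ • v, ⟨fun i hi => by simp [hv i hi], ?_⟩, _, hcoord _ ‖v‖ ?_⟩
    · have h2 := EuclideanSpace.norm_sq_eq v
      simp only [Real.norm_eq_abs, sq_abs] at h2
      simp only [PiLp.smul_apply, smul_eq_mul, mul_pow, ← Finset.mul_sum, ← h2]
      field_simp
    · rw [smul_smul, mul_inv_cancel₀ hn.ne', one_smul]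

/-- The inclusion `ℝᵖ⁺¹ → ℝᵖ⁺²`, `x ↦ (x, 0)`. -/
def equator : EuclideanSpace ℝ (Fin ((p : ℕ) + 1)) →L[ℝ] SliceSpace p :=
  LinearMap.toContinuousLinearMap
    { toFun := fun x => WithLp.toLp 2 (Fin.snoc (α := fun _ => ℝ) (fun i => x i) 0)
      map_add' := fun x y => by
        ext i; refine Fin.lastCases ?_ (fun j => ?_) i <;> simp
      map_smul' := fun c x => by
        ext i; refine Fin.lastCases ?_ (fun j => ?_) i <;> simp }

theorem equator_castSucc (x : EuclideanSpace ℝ (Fin ((p : ℕ) + 1))) (i : Fin ((p : ℕ) + 1)) :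
    equator p x i.castSucc = x i :=
  Fin.snoc_castSucc (α := fun _ => ℝ) _ _ _

theorem equator_last (x : EuclideanSpace ℝ (Fin ((p : ℕ) + 1))) : equator p x (Fin.last _) = 0 :=
  Fin.snoc_last (α := fun _ => ℝ) _ _

theorem injective_equator : Function.Injective (equator p) := fun x y h => by
  ext i
  rw [← equator_castSucc p x i, h, equator_castSucc]

theorem slicePoint_equator (w₁ w₂ : Octonion) (x : EuclideanSpace ℝ (Fin ((p : ℕ) + 1))) :
    slicePoint p w₁ (equator p x) = slicePoint p w₂ (equator p x) := by
  simp only [slicePoint, equator_last, zero_smul]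

theorem exists_slicePoint_equator {x : Octonion} (hx : x ∈ paravectors p) (w : Octonion) :
    ∃ y, slicePoint p w (equator p y) = x := by
  refine ⟨WithLp.toLp 2 fun i => x (Fin.castLE (by omega) i), ?_⟩
  simp only [slicePoint, equator_castSucc, equator_last, zero_smul, add_zero]
  ext k
  simp only [WithLp.ofLp_sum, Finset.sum_apply, PiLp.smul_apply, Octonion.e, smul_eq_mul]
  by_cases hk : (k : ℕ) ≤ p
  · rw [Finset.sum_eq_single ⟨k, by omega⟩]
    · simp
    · intro j _ hj
      have : k ≠ Fin.castLE (by omega) j := fun h => hj (by ext; simp [h])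
      simp [this]
    · simp
  · rw [hx k (by omega)]
    refine Finset.sum_eq_zero fun j _ => ?_
    have : k ≠ Fin.castLE (by omega) j := fun h => hk (by rw [h]; simp; omega)
    simp [this]

end Slices

/-! ### The identity theorem on slices and slice domains -/

theorem IsSmoothHypersurface.exists_local_immersion {p : Fin 7} {M : Type*} [TopologicalSpace M]
    [ChartedSpace (EuclideanSpace ℝ (Fin ((p : ℕ) + 1))) M] {ι : M → SliceSpace p}
    (hι : IsSmoothHypersurface p ι) (m : M) :
    ∃ (g : EuclideanSpace ℝ (Fin ((p : ℕ) + 1)) → SliceSpace p)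
      (y₀ : EuclideanSpace ℝ (Fin ((p : ℕ) + 1))),
      ContDiffAt ℝ 1 g y₀ ∧ Function.Injective (fderiv ℝ g y₀) ∧ ∀ y, ∃ m', g y = ι m' := by
  -- The inverse chart is a total function into `M`, so even its values off the chart target stay in
  -- the image of `ι`.
  refine ⟨ι ∘ (extChartAt (𝓡 ((p : ℕ) + 1)) m).symm, extChartAt (𝓡 ((p : ℕ) + 1)) m m, ?_, ?_,
    fun y => ⟨_, rfl⟩⟩
  · have h := (contMDiffAt_iff.1 (hι.1 m)).2
    simp only [modelWithCornersSelf_coe, Set.range_id, contDiffWithinAt_univ] at h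
    have h' : ContDiffAt ℝ ∞ (ι ∘ (extChartAt (𝓡 ((p : ℕ) + 1)) m).symm)
      (extChartAt (𝓡 ((p : ℕ) + 1)) m m) := h
    exact h'.of_le (by simp)
  · have h := hι.2 m
    rw [((hι.1 m).mdifferentiableAt (by simp)).mfderiv] at h
    simp only [modelWithCornersSelf_coe, Set.range_id, fderivWithin_univ] at h
    exact h

theorem IsMonogenicOnSlice.eq_zero_of_immersion {p : Fin 7} {w : Octonion} (hw : w ∈ imagSphere p)
    {Ω : Set Octonion} (hΩ : IsDomainSet (sliceOf p w Ω)) {f : Octonion → Octonion}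
    (hf : IsMonogenicOnSlice p w Ω f)
    {g : EuclideanSpace ℝ (Fin ((p : ℕ) + 1)) → SliceSpace p}
    {y₀ : EuclideanSpace ℝ (Fin ((p : ℕ) + 1))} (hg : ContDiffAt ℝ 1 g y₀)
    (hinj : Function.Injective (fderiv ℝ g y₀))
    (hgU : ∀ᶠ y in 𝓝 y₀, g y ∈ sliceOf p w Ω ∧ f (slicePoint p w (g y)) = 0) :
    ∀ x ∈ sliceOf p w Ω, f (slicePoint p w x) = 0 :=
  CliffordSymbol.eq_zero_of_eq_zero_on_immersion (m := (p : ℕ) + 1) (A := sliceSymbol p w)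
    (f := f ∘ slicePoint p w) (norm_sliceSymbol p hw) hΩ.1 hΩ.2.isPreconnected hf.1
    (fun x hx => by rw [← sliceDirac_eq_dirac]; exact hf.2 x hx) hg hinj hgU

theorem IsMonogenicOnSlice.eq_zero_of_hypersurface {p : Fin 7} {M : Type*} [TopologicalSpace M]
    [Nonempty M] [ChartedSpace (EuclideanSpace ℝ (Fin ((p : ℕ) + 1))) M] {ι : M → SliceSpace p}
    (hι : IsSmoothHypersurface p ι) {w : Octonion} (hw : w ∈ imagSphere p)
    {Ω : Set Octonion} (hΩ : IsDomainSet (sliceOf p w Ω)) {f : Octonion → Octonion}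
    (hf : IsMonogenicOnSlice p w Ω f)
    (h0 : ∀ m, ι m ∈ sliceOf p w Ω ∧ f (slicePoint p w (ι m)) = 0) :
    ∀ x ∈ sliceOf p w Ω, f (slicePoint p w x) = 0 := by
  obtain ⟨g, y₀, hg, hinj, hgι⟩ := hι.exists_local_immersion (Classical.arbitrary M)
  refine hf.eq_zero_of_immersion hw hΩ hg hinj (Eventually.of_forall fun y => ?_)
  obtain ⟨m', hm'⟩ := hgι y
  rw [hm']
  exact h0 m'

/-- Vanishing on the slice through η includes Ω ∩ ℝᵖ⁺¹. Near a point of that set `equator` is an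
immersed hypersurface of zeros in every other slice. -/
theorem IsGSM.eq_zero_of_hypersurface {p : Fin 7} {M : Type*} [TopologicalSpace M]
    [Nonempty M] [ChartedSpace (EuclideanSpace ℝ (Fin ((p : ℕ) + 1))) M] {ι : M → SliceSpace p}
    (hι : IsSmoothHypersurface p ι) {Ω : Set Octonion} (hΩ : IsSliceDomain p Ω)
    {f : Octonion → Octonion} (hf : IsGSM p Ω f) {η : Octonion} (hη : η ∈ imagSphere p)
    (h0 : ∀ m, ι m ∈ sliceOf p η Ω ∧ f (slicePoint p η (ι m)) = 0) : ∀ x ∈ Ω, f x = 0 := by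
  have hηz := (hf η hη).eq_zero_of_hypersurface hι hη (hΩ.2.2 η hη) h0
  intro x hx
  obtain ⟨w, hw, y, rfl⟩ := exists_slicePoint_eq p hη x
  obtain ⟨x₀, hx₀, hx₀p⟩ := hΩ.2.1
  obtain ⟨y₀, rfl⟩ := exists_slicePoint_equator p hx₀p w
  refine (hf w hw).eq_zero_of_immersion hw (hΩ.2.2 w hw) (g := equator p) (y₀ := y₀)
    (equator p).contDiff.contDiffAt ?_ ?_ y hx
  · rw [(equator p).fderiv]; exact injective_equator p
  · filter_upwards [(equator p).continuous.continuousAt.eventually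
      ((hΩ.2.2 w hw).1.eventually_mem hx₀)] with z hz
    refine ⟨hz, ?_⟩
    rw [slicePoint_equator p w η z]
    refine hηz _ ?_
    rw [sliceOf, Set.mem_preimage, slicePoint_equator p η w z]
    exact hz

theorem IsMonogenicOnSlice.sub {p : Fin 7} {w : Octonion} {Ω : Set Octonion}
    (hΩ : IsOpen (sliceOf p w Ω)) {f g : Octonion → Octonion} (hf : IsMonogenicOnSlice p w Ω f)
    (hg : IsMonogenicOnSlice p w Ω g) : IsMonogenicOnSlice p w Ω (fun x => f x - g x) := by
  refine ⟨hf.1.sub hg.1, fun x hx => ?_⟩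
  have hfd := (hf.1.differentiableOn one_ne_zero).differentiableAt (hΩ.mem_nhds hx)
  have hgd := (hg.1.differentiableOn one_ne_zero).differentiableAt (hΩ.mem_nhds hx)
  have h1 := hf.2 x hx
  have h2 := hg.2 x hx
  rw [sliceDirac_eq_dirac, CliffordSymbol.dirac_eq_diracCLM] at h1 h2 ⊢
  have h3 : HasFDerivAt ((fun x => f x - g x) ∘ slicePoint p w) _ x :=
    hfd.hasFDerivAt.sub hgd.hasFDerivAt
  rw [h3.fderiv, map_sub, h1, h2, sub_zero]

theorem mainTheorem2 (p : Fin 7)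
    {M : Type*} [TopologicalSpace M] [Nonempty M]
    [ChartedSpace (EuclideanSpace ℝ (Fin ((p : ℕ) + 1))) M]
    [IsManifold (𝓡 ((p : ℕ) + 1)) ∞ M]
    (ι : M → SliceSpace p) (hι : IsSmoothHypersurface p ι) :
    -- one slice
    (∀ Ω : Set Octonion, IsDomainSet Ω → ∀ η ∈ imagSphere p, IsDomainSet (sliceOf p η Ω) →
      ∀ f : Octonion → Octonion, IsMonogenicOnSlice p η Ω f →
      (∀ m, ι m ∈ sliceOf p η Ω ∧ f (slicePoint p η (ι m)) = 0) →
      ∀ x ∈ sliceOf p η Ω, f (slicePoint p η x) = 0) ∧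
    -- zeros on a slice domain
    (∀ Ω : Set Octonion, IsSliceDomain p Ω →
      ∀ f : Octonion → Octonion, IsGSM p Ω f →
      (∃ η ∈ imagSphere p, ∀ m, ι m ∈ sliceOf p η Ω ∧ f (slicePoint p η (ι m)) = 0) →
      ∀ x ∈ Ω, f x = 0) ∧
    -- identity theorem
    (∀ Ω : Set Octonion, IsSliceDomain p Ω →
      ∀ f g : Octonion → Octonion, IsGSM p Ω f → IsGSM p Ω g →
      (∃ w ∈ imagSphere p, ∀ m, ι m ∈ sliceOf p w Ω ∧
        f (slicePoint p w (ι m)) = g (slicePoint p w (ι m))) →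
      ∀ x ∈ Ω, f x = g x) := by
  refine ⟨fun Ω _ η hη hΩη f hf h0 => hf.eq_zero_of_hypersurface hι hη hΩη h0,
    fun Ω hΩ f hf ⟨η, hη, h0⟩ => hf.eq_zero_of_hypersurface hι hΩ hη h0,
    fun Ω hΩ f g hf hg ⟨w, hw, h0⟩ x hx => ?_⟩
  have hsub : IsGSM p Ω (fun x => f x - g x) := fun v hv =>
    (hf v hv).sub (hΩ.2.2 v hv).1 (hg v hv)
  exact sub_eq_zero.1 (hsub.eq_zero_of_hypersurface hι hΩ hw
    (fun m => ⟨(h0 m).1, sub_eq_zero.2 (h0 m).2⟩) x hx)
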